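/- Let $f_i:\mathbb R^{n_i}\to\mathbb R\cup\{+\infty\}$ be proper, closed and convex and let $\mathcal X_i\subseteq\mathbb R^{n_i}$ be nonempty, closed and convex ($i=1,2$). Put $f(\mathbf x)=f_1(\mathbf x_1)+f_2(\mathbf x_2)$, $\mathcal X=\mathcal X_1\times\mathcal X_2$, $\mathbf A\mathbf x=\mathbf A_1\mathbf x_1+\mathbf A_2\mathbf x_2$ with matrices $\mathbf A_i\in\mathbb R^{m\times n_i}$, and $\mathbf b\in\mathbb R^m$. Consider $$f^\star=\min\{f(\mathbf x):\mathbf x\in\mathcal X,\ \mathbf A\mathbf x=\mathbf b\},\qquad g(\mathbf y)=\inf_{\mathbf x\in\mathcal X}\{f(\mathbf x)+\mathbf y^T(\mathbf A\mathbf x-\mathbf b)\},\qquad g^\star=\sup_{\mathbf y\in\mathbb R^m}g(\mathbf y),$$ and let $\mathcal Y^\star$ be the set of maximizers of $g$. Assume that the minimum $f^\star$ is attained and finite, that $\sup_{\mathbf x\in\mathcal X}\|\mathbf A\mathbf x-\mathbf b\|_2<\infty$, and that at least one of the following holds: (a) $\mathcal X$ is a polytope and some $\mathbf x\in\mathcal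 X\cap\mathrm{relint}(\mathrm{dom} f)$ satisfies $\mathbf A\mathbf x=\mathbf b$; (b) some $\mathbf x\in\mathrm{relint}(\mathcal X\cap\mathrm{dom} f)$ satisfies $\mathbf A\mathbf x=\mathbf b$. (If $f$ is finite everywhere, this says that $\mathcal X$ is a polytope or that $\{\mathbf A\mathbf x=\mathbf b\}$ meets $\mathrm{relint}(\mathcal X)$.) Let $\gamma_0=3$ and, for $k\ge0$, $$\tau_k=\tfrac{3}{k+4},\quad \gamma_k=\tfrac{2\gamma_0}{k+2},\quad \beta_k=\tfrac{9(k+3)}{\gamma_0(k+1)(k+7)},\quad \rho_k=\tfrac{3\gamma_0}{(k+3)(k+4)},\quad \eta_k=\tfrac{\gamma_0}{k+3}.$$ Fix $\bar{\mathbf x}_1^c\in\mathcal X_1$. A block step at index $k$ from $(\hat{\mathbf y},\mathbf z_2)$ produces $\mathbf x=(\mathbf x_1,\mathbf x_2)$ and $\mathbf y$ with $$\begin{aligned} \mathbf x_1&\in\arg\min_{\mathbf u_1\in\mathcal X_1}\Big\{f_1(\mathbf u_1)+\tfrac{\gamma_{k+1}}2\|\mathbf A_1(\mathbf u_1-\bar{\mathbf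 x}_1^c)\|_2^2+\tfrac{\rho_k}2\|\mathbf A_1\mathbf u_1+\mathbf A_2\mathbf z_2-\mathbf b+\rho_k^{-1}\hat{\mathbf y}\|_2^2\Big\},\\ \mathbf x_2&\in\arg\min_{\mathbf u_2\in\mathcal X_2}\Big\{f_2(\mathbf u_2)+\tfrac{\eta_k}2\|\mathbf A_1\mathbf x_1+\mathbf A_2\mathbf u_2-\mathbf b+\eta_k^{-1}\hat{\mathbf y}\|_2^2\Big\},\\ \mathbf y&=\hat{\mathbf y}+\eta_k(\mathbf A\mathbf x-\mathbf b). \end{aligned}$$ Let $(\bar{\mathbf x}^0,\bar{\mathbf y}^0)$ be produced by a block step at index $0$ from $(\mathbf 0,\mathbf z_2)$ for some $\mathbf z_2\in\mathcal X_2$, let $\mathbf x_2^0\in\mathcal X_2$, and for $k\ge0$ let $$\hat{\mathbf y}^k=(1-\tau_k)\bar{\mathbf y}^k+\tau_k\beta_k^{-1}(\mathbf A\bar{\mathbf x}^k-\mathbf b),\qquad \bar{\mathbf x}^{k+1}=(1-\tau_k)\bar{\mathbf x}^k+\tau_k\mathbf x^{k+1},$$ where $(\mathbf x^{k+1},\bar{\mathbf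 y}^{k+1})$ is produced by a block step at index $k$ from $(\hat{\mathbf y}^k,\mathbf x_2^k)$. Put $D^1_{\mathcal X_1}=\frac12\sup_{\mathbf x_1\in\mathcal X_1}\|\mathbf A_1(\mathbf x_1-\bar{\mathbf x}_1^c)\|_2^2$ and $D^{\mathbf A}_{\mathcal X}=\frac12\sup_{\mathbf x\in\mathcal X}\|\mathbf A\mathbf x-\mathbf b\|_2^2$. Then $D_{\mathcal Y^\star}:=\min\{\|\mathbf y\|_2:\mathbf y\in\mathcal Y^\star\}$ exists and, with $$D_{\max}=\max\Big\{D^1_{\mathcal X_1}+3D^{\mathbf A}_{\mathcal X},\ D_{\mathcal Y^\star}\Big(D_{\mathcal Y^\star}+\sqrt{D^1_{\mathcal X_1}+4D^{\mathbf A}_{\mathcal X}}\Big)\Big\},$$ for all $k\ge0$ $$|f(\bar{\mathbf x}^k)-f^\star|\le\frac{6D_{\max}}{k+2},\qquad \|\mathbf A\bar{\mathbf x}^k-\mathbf b\|_2\le\frac{6\Big[D_{\mathcal Y^\star}+\sqrt{D^1_{\mathcal X_1}+4D^{\mathbf A}_{\mathcal X}}\Big]}{k+2}.$$ Consequently an $\varepsilon$-primal-dual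 solution is reached in $O(\varepsilon^{-1})$ iterations: for every $\varepsilon>0$ and every $k$ with $$k+2\ \ge\ \frac{12}{\varepsilon}\max\Big\{D_{\max},\ D_{\mathcal Y^\star}+\sqrt{D^1_{\mathcal X_1}+4D^{\mathbf A}_{\mathcal X}}\Big\}$$ one has $\bar{\mathbf x}^k\in\mathcal X$, $|f(\bar{\mathbf x}^k)-f^\star|\le\varepsilon$, $\|\mathbf A\bar{\mathbf x}^k-\mathbf b\|_2\le\varepsilon$ and $|g(\bar{\mathbf y}^k)-g^\star|\le\varepsilon$. -/

import Mathlib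

namespace PADMM

/-- Euclidean space of dimension `n`. -/
abbrev Vec (n : ℕ) := EuclideanSpace ℝ (Fin n)

/-- A proper, closed (lower semicontinuous), convex function with values in `ℝ ∪ {+∞}`. -/
structure ProperClosedConvex {n : ℕ} (f : Vec n → EReal) : Prop where
  ne_bot : ∀ x, f x ≠ ⊥
  exists_ne_top : ∃ x, f x ≠ ⊤
  closed : LowerSemicontinuous f
  convex : Convex ℝ {p : Vec n × ℝ | f p.1 ≤ (p.2 : EReal)}

/-- The data of a two-block problem: minimize `f₁ x₁ + f₂ x₂` over `x₁ ∈ X₁`, `x₂ ∈ X₂`,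
subject to `A₁ x₁ + A₂ x₂ = b`. -/
structure Problem (n₁ n₂ m : ℕ) where
  f₁ : Vec n₁ → EReal
  f₂ : Vec n₂ → EReal
  X₁ : Set (Vec n₁)
  X₂ : Set (Vec n₂)
  A₁ : Vec n₁ →L[ℝ] Vec m
  A₂ : Vec n₂ →L[ℝ] Vec m
  b : Vec m

namespace Problem

variable {n₁ n₂ m : ℕ} (P : Problem n₁ n₂ m)

/-- The objective `f`. -/
noncomputable def obj (x : Vec n₁ × Vec n₂) : EReal := P.f₁ x.1 + P.f₂ x.2

/-- The set `X = X₁ × X₂`. -/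
def X : Set (Vec n₁ × Vec n₂) := P.X₁ ×ˢ P.X₂

/-- The effective domain of `f`. -/
def dom : Set (Vec n₁ × Vec n₂) := {x | P.f₁ x.1 ≠ ⊤ ∧ P.f₂ x.2 ≠ ⊤}

/-- The residual `A x - b`. -/
def res (x : Vec n₁ × Vec n₂) : Vec m := P.A₁ x.1 + P.A₂ x.2 - P.b

/-- The feasible points: `x ∈ X` with `A x = b`. -/
def feasible : Set (Vec n₁ × Vec n₂) := {x | x ∈ P.X ∧ P.res x = 0}

/-- The optimal value `f*`. -/
noncomputable def optVal : EReal := ⨅ x ∈ P.feasible, P.obj x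

/-- The primal solution set `X*`. -/
def primalSolutions : Set (Vec n₁ × Vec n₂) :=
  {x | x ∈ P.feasible ∧ P.obj x ≠ ⊤ ∧ ∀ z ∈ P.feasible, P.obj x ≤ P.obj z}

/-- The dual function `g`. -/
noncomputable def dual (y : Vec m) : EReal :=
  ⨅ x ∈ P.X, P.obj x + ((inner ℝ y (P.res x) : ℝ) : EReal)

/-- The dual optimal value `g*`. -/
noncomputable def dualVal : EReal := ⨆ y, P.dual y

/-- The dual solution set `Y*`. -/
def dualSolutions : Set (Vec m) := {y | ∀ z, P.dual z ≤ P.dual y}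

/-- The standing assumption. In the last field, if `f` is finite on the whole space (or just on an
open set containing `X`), the two alternatives say that `X` is a polytope, respectively that some
`x` in the relative interior of `X` satisfies `A x = b`. -/
structure Standing : Prop where
  f₁_pcc : ProperClosedConvex P.f₁
  f₂_pcc : ProperClosedConvex P.f₂
  X₁_closed : IsClosed P.X₁
  X₂_closed : IsClosed P.X₂
  X₁_convex : Convex ℝ P.X₁
  X₂_convex : Convex ℝ P.X₂
  X_nonempty : P.X.Nonempty
  solvable : P.primalSolutions.Nonempty
  qualification :
    ((∃ S : Finset (Vec n₁ × Vec n₂), P.X = convexHull ℝ (S : Set (Vec n₁ × Vec n₂))) ∧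
      ∃ x ∈ P.feasible, x ∈ intrinsicInterior ℝ P.dom) ∨
    ∃ x ∈ intrinsicInterior ℝ (P.X ∩ P.dom), P.res x = 0

/-- `(1/2) sup {‖A₁ (x₁ - xc)‖² : x₁ ∈ X₁}`. -/
noncomputable def D₁ (xc : Vec n₁) : ℝ :=
  (1 / 2) * sSup ((fun x₁ => ‖P.A₁ (x₁ - xc)‖ ^ 2) '' P.X₁)

/-- `(1/2) sup {‖A x - b‖² : x ∈ X}`. -/
noncomputable def DA : ℝ := (1 / 2) * sSup ((fun x => ‖P.res x‖ ^ 2) '' P.X)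

/-- `max {D₁ + 3 DA, DY (DY + √(D₁ + 4 DA))}`, where `DY` is the least norm of a dual solution. -/
noncomputable def Dmax (xc : Vec n₁) (DY : ℝ) : ℝ :=
  max (P.D₁ xc + 3 * P.DA) (DY * (DY + √(P.D₁ xc + 4 * P.DA)))

/-- `x` is an `ε`-solution: `x ∈ X`, `|f x - f*| ≤ ε` and `‖A x - b‖ ≤ ε`. -/
def IsApproxSolution (ε : ℝ) (x : Vec n₁ × Vec n₂) : Prop :=
  x ∈ P.X ∧ (∃ v s : ℝ, P.obj x = v ∧ P.optVal = s ∧ |v - s| ≤ ε) ∧ ‖P.res x‖ ≤ ε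

/-- `(x, y)` is an `ε`-primal-dual solution: `x` is an `ε`-solution and `|g y - g*| ≤ ε`. -/
def IsApproxPrimalDual (ε : ℝ) (x : Vec n₁ × Vec n₂) (y : Vec m) : Prop :=
  P.IsApproxSolution ε x ∧ ∃ v s : ℝ, P.dual y = v ∧ P.dualVal = s ∧ |v - s| ≤ ε

end Problem

/-! The parameter schedule; `γ₀` is the free parameter. -/

noncomputable def tau (k : ℕ) : ℝ := 3 / (k + 4)

noncomputable def gam (γ₀ : ℝ) (k : ℕ) : ℝ := 2 * γ₀ / (k + 2)

noncomputable def bet (γ₀ : ℝ) (k : ℕ) : ℝ := 9 * (k + 3) / (γ₀ * (k + 1) * (k + 7))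

noncomputable def rho (γ₀ : ℝ) (k : ℕ) : ℝ := 3 * γ₀ / ((k + 3) * (k + 4))

noncomputable def eta (γ₀ : ℝ) (k : ℕ) : ℝ := γ₀ / (k + 3)

variable {n₁ n₂ m : ℕ}

/-- The two alternating minimizations and the dual ascent step at index `k`: from the multiplier
`yh` and the previous second block `z₂`, compute `x = (x₁, x₂)` and the new dual point `y`. -/
structure IsBlockStep (P : Problem n₁ n₂ m) (γ₀ : ℝ) (xc : Vec n₁) (k : ℕ) (yh : Vec m)
    (z₂ : Vec n₂) (x : Vec n₁ × Vec n₂) (y : Vec m) : Prop where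
  mem₁ : x.1 ∈ P.X₁
  min₁ : IsMinOn (fun x₁ => P.f₁ x₁ +
    (((gam γ₀ (k + 1) / 2) * ‖P.A₁ (x₁ - xc)‖ ^ 2 +
      (rho γ₀ k / 2) * ‖P.A₁ x₁ + P.A₂ z₂ - P.b + (rho γ₀ k)⁻¹ • yh‖ ^ 2 : ℝ) : EReal))
    P.X₁ x.1
  mem₂ : x.2 ∈ P.X₂
  min₂ : IsMinOn (fun x₂ => P.f₂ x₂ +
    (((eta γ₀ k / 2) * ‖P.A₁ x.1 + P.A₂ x₂ - P.b + (eta γ₀ k)⁻¹ • yh‖ ^ 2 : ℝ) : EReal))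
    P.X₂ x.2
  dual_eq : y = yh + eta γ₀ k • P.res x

/-- `(xb k, yb k)` is generated by the ADMM scheme with center `xc`; `x k` and `yh k` are the
auxiliary sequences. The starting point `(xb 0, yb 0)` comes from the block step at index `0` with
multiplier `0` and any second block in `X₂`; of `x 0` only the second block is used. -/
structure IsRun (P : Problem n₁ n₂ m) (γ₀ : ℝ) (xc : Vec n₁) (x xb : ℕ → Vec n₁ × Vec n₂)
    (yh yb : ℕ → Vec m) : Prop where
  center_mem : xc ∈ P.X₁
  init_mem : (x 0).2 ∈ P.X₂
  start : ∃ z₂ ∈ P.X₂, IsBlockStep P γ₀ xc 0 0 z₂ (xb 0) (yb 0)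
  yh_eq : ∀ k, yh k = (1 - tau k) • yb k + (tau k * (bet γ₀ k)⁻¹) • P.res (xb k)
  step : ∀ k, IsBlockStep P γ₀ xc k (yh k) (x k).2 (x (k + 1)) (yb (k + 1))
  xb_eq : ∀ k, xb (k + 1) = (1 - tau k) • xb k + tau k • x (k + 1)

end PADMM

/-!
There is no duality gap. Normalize the optimal value to `0`. Under (b), a Lagrange multiplier is a
Riesz extension of the height functional from the vertical axis to the span of the image of the
epigraph: since the feasible point lies in the relative interior of the domain, the cone generated
by this image is large enough for the extension. Under (a), the polytope is parametrized by a
simplex, and the coordinate inequalities are added one at a time: one with a strictly feasible point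
has a Slater multiplier, and one which is tight on the whole feasible set may be treated as an
equality.

For the rates, first-order optimality in the two minimizations of a block step bounds the Lagrangian
at the new multiplier from below. Averaging the iterates then preserves the excessive gap condition:
the objective at `xb k` with penalty `‖A x - b‖² / (2 β_k)` exceeds the dual function at `yb k`,
smoothed with parameter `γ_k`, by at most `3 γ_k DA`. Comparison with a dual solution `y` of least
norm, for which `f* ≤ f x + ‖y‖ ‖A x - b‖` on `X`, gives a quadratic inequality for the residual.
As `β_k` and `γ_k` are `O(1 / k)`, it yields the feasibility rate, and with it the other two.
-/

namespace PADMM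

section Multipliers

variable {E F : Type*} [AddCommGroup E] [Module ℝ E] [AddCommGroup F] [Module ℝ F]

/-- `z` lies in the algebraic relative interior of `D`: every segment from a point of `D` to `z`
can be prolonged inside `D`. -/
def IsRelCorePoint (D : Set E) (z : E) : Prop :=
  z ∈ D ∧ ∀ x ∈ D, ∃ ε : ℝ, 0 < ε ∧ z - ε • (x - z) ∈ D

theorem IsRelCorePoint.preimage {D : Set F} {L : E →ₗ[ℝ] F} {w : E}
    (hw : IsRelCorePoint D (L w)) : IsRelCorePoint (L ⁻¹' D) w := by
  refine ⟨hw.1, fun x hx => ?_⟩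
  obtain ⟨ε, hε, hmem⟩ := hw.2 (L x) hx
  exact ⟨ε, hε, by simpa only [Set.mem_preimage, map_sub, map_smul] using hmem⟩

theorem isRelCorePoint_of_mem_intrinsicInterior {V : Type*} [NormedAddCommGroup V]
    [NormedSpace ℝ V] {D : Set V} {z : V} (hz : z ∈ intrinsicInterior ℝ D) :
    IsRelCorePoint D z := by
  refine ⟨intrinsicInterior_subset hz, fun x hx => ?_⟩
  obtain ⟨w, hw, rfl⟩ := mem_intrinsicInterior.1 hz
  let ray : ℝ → affineSpan ℝ D := fun t =>
    ⟨AffineMap.lineMap (w : V) x (-t), AffineMap.lineMap_mem _ w.2 (subset_affineSpan ℝ D hx)⟩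
  have hray : Continuous ray :=
    (AffineMap.lineMap_continuous.comp continuous_neg).subtype_mk _
  have hray_zero : ray 0 = w := Subtype.ext (by simp [ray])
  have hnear : ∀ᶠ t in nhds (0 : ℝ), (ray t : V) ∈ D :=
    hray.continuousAt.eventually (by rw [hray_zero]; exact mem_interior_iff_mem_nhds.1 hw)
  obtain ⟨ε, hmem, hε⟩ :=
    ((hnear.filter_mono nhdsWithin_le_nhds).and (self_mem_nhdsWithin (s := Set.Ioi 0))).exists
  refine ⟨ε, hε, ?_⟩
  convert hmem using 1
  simp only [ray, AffineMap.lineMap_apply, vsub_eq_sub, vadd_eq_add]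
  module

open scoped Pointwise in
theorem mem_pointedCone_hull_iff {s : Set E} (hs : Convex ℝ s) (hne : s.Nonempty) {x : E} :
    x ∈ PointedCone.hull ℝ s ↔ ∃ c : ℝ, 0 ≤ c ∧ ∃ y ∈ s, c • y = x := by
  constructor
  · intro hx
    induction hx using Submodule.span_induction with
    | mem x hx => exact ⟨1, zero_le_one, x, hx, one_smul ℝ x⟩
    | zero => exact ⟨0, le_rfl, hne.some, hne.some_mem, zero_smul ℝ _⟩
    | add _ _ _ _ hx hy =>
      obtain ⟨c, hc, x, hx, rfl⟩ := hx
      obtain ⟨d, hd, y, hy, rfl⟩ := hy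
      obtain ⟨z, hz, hsum⟩ : c • x + d • y ∈ (c + d) • s := by
        rw [hs.add_smul hc hd]
        exact Set.add_mem_add (Set.smul_mem_smul_set hx) (Set.smul_mem_smul_set hy)
      exact ⟨c + d, add_nonneg hc hd, z, hz, hsum⟩
    | smul a _ _ hx =>
      obtain ⟨c, hc, x, hx, rfl⟩ := hx
      exact ⟨a * c, mul_nonneg a.2 hc, x, hx, mul_smul (a : ℝ) c x⟩
  · rintro ⟨c, hc, y, hy, rfl⟩
    exact (PointedCone.hull ℝ s).smul_mem hc (PointedCone.subset_hull hy)

theorem exists_mem_pointedCone_hull_of_reflect {s : Set (F × ℝ)}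
    (hspan : Submodule.span ℝ (Prod.fst '' s) = ⊤)
    (hrefl : ∀ p ∈ s, ∃ ε : ℝ, 0 < ε ∧ ∃ t, (-(ε • p.1), t) ∈ s) (w : F) :
    ∃ t, (w, t) ∈ PointedCone.hull ℝ s := by
  set K : PointedCone ℝ (F × ℝ) := PointedCone.hull ℝ s
  have hlineal : ⊤ ≤ (K.map (LinearMap.fst ℝ F ℝ)).lineal := by
    rw [← hspan, Submodule.span_le]
    rintro _ ⟨p, hp, rfl⟩
    obtain ⟨ε, hε, t, ht⟩ := hrefl p hp
    have hneg : ε⁻¹ • ((-(ε • p.1), t) : F × ℝ) ∈ K :=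
      K.smul_mem (inv_pos.2 hε).le (PointedCone.subset_hull ht)
    refine PointedCone.mem_lineal.2 ⟨PointedCone.mem_map.2 ⟨p, PointedCone.subset_hull hp, rfl⟩,
      PointedCone.mem_map.2 ⟨_, hneg, ?_⟩⟩
    simp [smul_smul, inv_mul_cancel₀ hε.ne']
  obtain ⟨⟨_, t⟩, ht, rfl⟩ :=
    PointedCone.mem_map.1 (PointedCone.mem_lineal.1 (hlineal (Submodule.mem_top (x := w)))).1
  exact ⟨t, ht⟩

/-- Riesz extension of `(0, t) ↦ t`, which is nonnegative on the cone generated by `s`. -/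
theorem exists_linearMap_nonneg_of_convex {s : Set (F × ℝ)} (hs : Convex ℝ s) (hne : s.Nonempty)
    (hspan : Submodule.span ℝ (Prod.fst '' s) = ⊤)
    (hrefl : ∀ p ∈ s, ∃ ε : ℝ, 0 < ε ∧ ∃ t, (-(ε • p.1), t) ∈ s)
    (hzero : ∀ t, (0, t) ∈ s → 0 ≤ t) :
    ∃ l : F →ₗ[ℝ] ℝ, ∀ p ∈ s, 0 ≤ p.2 + l p.1 := by
  set K : PointedCone ℝ (F × ℝ) := PointedCone.hull ℝ s
  have hsK : ∀ p ∈ s, p ∈ K := fun p hp => PointedCone.subset_hull hp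
  have hvert : ∀ t, (0, t) ∈ K → 0 ≤ t := by
    intro t ht
    obtain ⟨c, hc, ⟨w, r⟩, hp, hcp⟩ := (mem_pointedCone_hull_iff hs hne).1 ht
    obtain ⟨hw, rfl⟩ := Prod.mk.inj hcp
    rcases smul_eq_zero.1 hw with rfl | rfl
    · simp
    · exact mul_nonneg hc (hzero r hp)
  let vert : (F × ℝ) →ₗ.[ℝ] ℝ :=
    { domain := Submodule.prod ⊥ ⊤
      toFun := (LinearMap.snd ℝ F ℝ).domRestrict _ }
  obtain ⟨g, hg_vert, hg⟩ := riesz_extension K vert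
    (by
      rintro ⟨⟨w, t⟩, hw⟩ ht
      obtain rfl : w = 0 := by simpa [vert] using hw
      exact hvert t ht)
    (by
      rintro ⟨w, t⟩
      obtain ⟨r, hr⟩ := exists_mem_pointedCone_hull_of_reflect hspan hrefl w
      exact ⟨⟨(0, r - t), by simp [vert]⟩, by simpa using hr⟩)
  refine ⟨g.comp (LinearMap.inl ℝ F ℝ), fun p hp => ?_⟩
  have hsnd : g (0, p.2) = p.2 := hg_vert ⟨(0, p.2), by simp [vert]⟩
  calc 0 ≤ g p := hg p (hsK p hp)
    _ = g (0, p.2) + g (p.1, 0) := by rw [← map_add]; simp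
    _ = p.2 + g.comp (LinearMap.inl ℝ F ℝ) p.1 := by rw [hsnd]; rfl

/-- The cone of the Riesz extension is generated by the image of the epigraph of `φ` under
`(x, t) ↦ (h x, t)`, inside the product of the span of the values of `h` on `D` with `ℝ`. -/
theorem exists_multiplier_of_isRelCorePoint {D : Set E} {φ : E → ℝ} (hφ : ConvexOn ℝ D φ)
    (h : E →ᵃ[ℝ] F) {z : E} (hz : IsRelCorePoint D z) (hz0 : h z = 0)
    (hnonneg : ∀ x ∈ D, h x = 0 → 0 ≤ φ x) :
    ∃ l : F →ₗ[ℝ] ℝ, ∀ x ∈ D, 0 ≤ φ x + l (h x) := by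
  let W : Submodule ℝ F := Submodule.span ℝ (h '' D)
  have hW : ∀ {x}, x ∈ D → h x ∈ W := fun hx => Submodule.subset_span ⟨_, hx, rfl⟩
  let s : Set (W × ℝ) := {p | ∃ x ∈ D, h x = p.1 ∧ φ x ≤ p.2}
  have hs : Convex ℝ s := by
    rintro p ⟨x, hx, hxp, hxφ⟩ q ⟨y, hy, hyq, hyφ⟩ a b ha hb hab
    refine ⟨a • x + b • y, hφ.1 hx hy ha hb hab, ?_, (hφ.2 hx hy ha hb hab).trans ?_⟩
    · rw [Convex.combo_affine_apply hab, hxp, hyq]; rfl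
    · exact add_le_add (mul_le_mul_of_nonneg_left hxφ ha) (mul_le_mul_of_nonneg_left hyφ hb)
  have hspan : Submodule.span ℝ (Prod.fst '' s) = ⊤ := by
    convert Submodule.span_span_coe_preimage (R := ℝ) (s := h '' D) using 2
    ext w
    constructor
    · rintro ⟨p, ⟨x, hx, hxp, -⟩, rfl⟩
      exact ⟨x, hx, hxp⟩
    · rintro ⟨x, hx, hxw⟩
      exact ⟨(w, φ x), ⟨x, hx, hxw, le_rfl⟩, rfl⟩
  have hrefl : ∀ p ∈ s, ∃ ε : ℝ, 0 < ε ∧ ∃ t, (-(ε • p.1), t) ∈ s := by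
    rintro p ⟨x, hx, hxp, -⟩
    obtain ⟨ε, hε, hmem⟩ := hz.2 x hx
    refine ⟨ε, hε, φ (z - ε • (x - z)), _, hmem, ?_, le_rfl⟩
    have hcombo : z - ε • (x - z) = (1 + ε) • z + (-ε) • x := by module
    rw [hcombo, Convex.combo_affine_apply (by ring), hz0, hxp]
    simp
  obtain ⟨l, hl⟩ := exists_linearMap_nonneg_of_convex hs ⟨(0, φ z), z, hz.1, hz0, le_rfl⟩ hspan
    hrefl (fun t ⟨x, hx, hx0, hxt⟩ => (hnonneg x hx hx0).trans hxt)
  obtain ⟨L, hL⟩ := l.exists_extend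
  refine ⟨L, fun x hx => ?_⟩
  have hLx : L (h x) = l ⟨h x, hW hx⟩ := LinearMap.congr_fun hL ⟨h x, hW hx⟩
  rw [hLx]
  exact hl (⟨h x, hW hx⟩, φ x) ⟨x, hx, rfl, le_rfl⟩

theorem exists_multiplier_of_pos {D : Set E} {φ : E → ℝ} (hφ : ConvexOn ℝ D φ) (a : E →ᵃ[ℝ] ℝ)
    {z : E} (hz : z ∈ D) (haz : 0 < a z) (hnonneg : ∀ x ∈ D, 0 ≤ a x → 0 ≤ φ x) :
    ∃ μ : ℝ, 0 ≤ μ ∧ ∀ x ∈ D, μ * a x ≤ φ x := by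
  have slope_le : ∀ x ∈ D, a x < 0 → ∀ y ∈ D, 0 < a y → φ x / a x ≤ φ y / a y := by
    intro x hx hax y hy hay
    have hd : 0 < a y - a x := by linarith
    have hab : a y / (a y - a x) + -a x / (a y - a x) = 1 := by
      rw [← add_div, ← sub_eq_add_neg, div_self hd.ne']
    have hα : 0 ≤ a y / (a y - a x) := by positivity
    have hβ : 0 ≤ -a x / (a y - a x) := div_nonneg (by linarith) hd.le
    have hzero : a ((a y / (a y - a x)) • x + (-a x / (a y - a x)) • y) = 0 := by
      rw [Convex.combo_affine_apply hab, smul_eq_mul, smul_eq_mul]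
      ring
    have hconv := (hnonneg _ (hφ.1 hx hy hα hβ hab) hzero.ge).trans (hφ.2 hx hy hα hβ hab)
    rw [smul_eq_mul, smul_eq_mul, div_mul_eq_mul_div, div_mul_eq_mul_div, ← add_div,
      le_div_iff₀ hd] at hconv
    rw [← neg_div_neg_eq (φ x), div_le_div_iff₀ (by linarith) hay]
    linarith
  let S : Set ℝ := insert 0 ((fun x => φ x / a x) '' {x ∈ D | a x < 0})
  have hS : ∀ y ∈ D, 0 < a y → ∀ r ∈ S, r ≤ φ y / a y := by
    rintro y hy hay r (rfl | ⟨x, ⟨hx, hax⟩, rfl⟩)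
    · exact div_nonneg (hnonneg y hy hay.le) hay.le
    · exact slope_le x hx hax y hy hay
  have hbdd : BddAbove S := ⟨_, hS z hz haz⟩
  refine ⟨sSup S, le_csSup hbdd (Set.mem_insert _ _), fun x hx => ?_⟩
  rcases lt_trichotomy (a x) 0 with hax | hax | hax
  · exact (div_le_iff_of_neg hax).1 (le_csSup hbdd (Set.mem_insert_of_mem _ ⟨x, ⟨hx, hax⟩, rfl⟩))
  · simpa only [hax, mul_zero] using hnonneg x hx hax.ge
  · exact (le_div_iff₀ hax).1 (csSup_le (Set.insert_nonempty _ _) (hS x hx hax))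

end Multipliers

section AffineInequalities

universe u v

variable {E : Type u} [AddCommGroup E] [Module ℝ E]

/-- Lagrange multipliers for the program of minimizing `φ` over `D` subject to `h x = 0` and
`0 ≤ a x` for `a ∈ s`, normalized to have value `0`. The multipliers of the inequalities are
encoded by the conic combination `p` of constraints that they define. -/
def HasMultipliers {F : Type v} [AddCommGroup F] [Module ℝ F] (D : Set E) (φ : E → ℝ)
    (h : E →ᵃ[ℝ] F) (s : Set (E →ᵃ[ℝ] ℝ)) : Prop :=
  ∃ l : F →ₗ[ℝ] ℝ, ∃ p ∈ PointedCone.hull ℝ s, ∀ x ∈ D, p x ≤ φ x + l (h x)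

theorem nonneg_of_mem_pointedCone_hull {s : Set (E →ᵃ[ℝ] ℝ)} {x : E} (hx : ∀ a ∈ s, 0 ≤ a x)
    {p : E →ᵃ[ℝ] ℝ} (hp : p ∈ PointedCone.hull ℝ s) : 0 ≤ p x := by
  induction hp using Submodule.span_induction with
  | mem a ha => exact hx a ha
  | zero => exact le_rfl
  | add p q _ _ hp hq => exact add_nonneg hp hq
  | smul c p _ hp => exact mul_nonneg c.2 hp

theorem convexOn_sub_affineMap {D : Set E} {φ : E → ℝ} (hφ : ConvexOn ℝ D φ) (a : E →ᵃ[ℝ] ℝ) :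
    ConvexOn ℝ D (φ - ⇑a) :=
  hφ.sub (((concaveOn_id convex_univ).comp_affineMap a).subset (Set.subset_univ D) hφ.1)

section

variable {F : Type v} [AddCommGroup F] [Module ℝ F] {D : Set E} {φ : E → ℝ} {h : E →ᵃ[ℝ] F}
  {s : Set (E →ᵃ[ℝ] ℝ)} {a : E →ᵃ[ℝ] ℝ}

theorem HasMultipliers.insert_of_sub {μ : ℝ} (hμ : 0 ≤ μ)
    (H : HasMultipliers D (φ - (μ • a : E →ᵃ[ℝ] ℝ)) h s) : HasMultipliers D φ h (insert a s) := by
  obtain ⟨l, p, hp, hle⟩ := H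
  refine ⟨l, p + μ • a, add_mem (Submodule.span_mono (Set.subset_insert _ _) hp)
    (PointedCone.smul_mem _ hμ (PointedCone.subset_hull (Set.mem_insert _ _))), fun x hx => ?_⟩
  have hxle := hle x hx
  simp only [Pi.sub_apply, AffineMap.coe_add, AffineMap.coe_smul, Pi.add_apply, Pi.smul_apply]
    at hxle ⊢
  linarith

theorem HasMultipliers.insert_of_prod (H : HasMultipliers D φ (h.prod a) s)
    (Ha : HasMultipliers D (0 - ⇑a) h s) : HasMultipliers D φ h (insert a s) := by
  obtain ⟨l, p, hp, hle⟩ := H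
  obtain ⟨l', p', hp', hle'⟩ := Ha
  have hmono : ∀ {q}, q ∈ PointedCone.hull ℝ s → q ∈ PointedCone.hull ℝ (insert a s) :=
    fun hq => Submodule.span_mono (Set.subset_insert _ _) hq
  set ν : ℝ := l (0, 1)
  have hl : ∀ x, l (h.prod a x) = l.comp (LinearMap.inl ℝ F ℝ) (h x) + ν * a x := by
    intro x
    have hx : h.prod a x = (h x, 0) + a x • ((0, 1) : F × ℝ) := by simp
    rw [hx, map_add, map_smul, smul_eq_mul, mul_comm]
    rfl
  simp only [hl] at hle
  rcases le_total ν 0 with hν | hν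
  · refine ⟨l.comp (LinearMap.inl ℝ F ℝ), p + (-ν) • a, add_mem (hmono hp)
      (PointedCone.smul_mem _ (neg_nonneg.2 hν) (PointedCone.subset_hull (Set.mem_insert _ _))),
      fun x hx => ?_⟩
    have hxle := hle x hx
    simp only [AffineMap.coe_add, AffineMap.coe_smul, Pi.add_apply, Pi.smul_apply, smul_eq_mul]
    linarith
  · refine ⟨l.comp (LinearMap.inl ℝ F ℝ) + ν • l', p + ν • p',
      hmono (add_mem hp (PointedCone.smul_mem _ hν hp')), fun x hx => ?_⟩
    have hxle := hle x hx
    have hxle' := mul_le_mul_of_nonneg_left (hle' x hx) hν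
    simp only [Pi.sub_apply, Pi.zero_apply, AffineMap.coe_add, AffineMap.coe_smul, Pi.add_apply,
      Pi.smul_apply, smul_eq_mul, LinearMap.add_apply, LinearMap.smul_apply] at hxle' ⊢
    linarith

theorem convex_inter_affine (hD : Convex ℝ D) (h : E →ᵃ[ℝ] F) (s : Set (E →ᵃ[ℝ] ℝ)) :
    Convex ℝ {x ∈ D | h x = 0 ∧ ∀ a ∈ s, 0 ≤ a x} := by
  have hineq : Convex ℝ (⋂ a ∈ s, a ⁻¹' Set.Ici (0 : ℝ)) :=
    convex_iInter₂ fun a _ => (convex_Ici 0).affine_preimage a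
  convert hD.inter (((convex_singleton (0 : F)).affine_preimage h).inter hineq) using 1
  ext x
  simp only [Set.mem_ofPred_eq, Set.mem_inter_iff, Set.mem_preimage, Set.mem_singleton_iff,
    Set.mem_iInter, Set.mem_Ici]

end

/-- Affine inequalities need no Slater point: if `a` vanishes on all feasible points, then it is
treated as an equality constraint, whose multiplier has the right sign after adding a multiple of
the multipliers that prove `a ≤ 0` on the feasible set. -/
theorem hasMultipliers_of_isRelCorePoint {D : Set E} {z : E} (hz : IsRelCorePoint D z)
    {s : Set (E →ᵃ[ℝ] ℝ)} (hs : s.Finite) (hsz : ∀ a ∈ s, 0 ≤ a z) :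
    ∀ {F : Type v} [AddCommGroup F] [Module ℝ F] {φ : E → ℝ} {h : E →ᵃ[ℝ] F},
      ConvexOn ℝ D φ → h z = 0 → (∀ x ∈ D, h x = 0 → (∀ a ∈ s, 0 ≤ a x) → 0 ≤ φ x) →
      HasMultipliers D φ h s := by
  induction s, hs using Set.Finite.induction_on with
  | empty =>
    intro F _ _ φ h hφ hz0 hnonneg
    obtain ⟨l, hl⟩ := exists_multiplier_of_isRelCorePoint hφ h hz hz0
      fun x hx hx0 => hnonneg x hx hx0 (by simp)
    exact ⟨l, 0, zero_mem _, hl⟩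
  | @insert a s _ _ ih =>
    intro F _ _ φ h hφ hz0 hnonneg
    simp only [Set.forall_mem_insert] at hsz hnonneg
    obtain ⟨haz, hsz⟩ := hsz
    by_cases hslater : ∃ y ∈ D, h y = 0 ∧ (∀ b ∈ s, 0 ≤ b y) ∧ 0 < a y
    · obtain ⟨y, hyD, hy0, hys, hya⟩ := hslater
      obtain ⟨μ, hμ, hle⟩ := exists_multiplier_of_pos
        (hφ.subset (fun x hx => hx.1) (convex_inter_affine hφ.1 h s)) a ⟨hyD, hy0, hys⟩ hya
        fun x hx hax => hnonneg x hx.1 hx.2.1 ⟨hax, hx.2.2⟩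
      exact .insert_of_sub hμ (ih hsz (convexOn_sub_affineMap hφ _) hz0
        fun x hx hx0 hxs => sub_nonneg.2 (hle x ⟨hx, hx0, hxs⟩))
    · push Not at hslater
      have haz0 : a z = 0 := le_antisymm (hslater z hz.1 hz0 hsz) haz
      refine .insert_of_prod (ih hsz hφ (by simp [hz0, haz0]) fun x hx hx0 hxs => ?_)
        (ih hsz (convexOn_sub_affineMap (convexOn_const 0 hφ.1) a) hz0
          fun x hx hx0 hxs => sub_nonneg.2 (hslater x hx hx0 hxs))
      rw [AffineMap.prod_apply, Prod.mk_eq_zero] at hx0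
      exact hnonneg x hx hx0.1 ⟨hx0.2.ge, hxs⟩

theorem exists_multiplier_of_polytope {F : Type v} [AddCommGroup F] [Module ℝ F] {S : Set E}
    (hS : S.Finite) {D : Set E} {φ : E → ℝ} (hφ : ConvexOn ℝ D φ) (h : E →ᵃ[ℝ] F) {z : E}
    (hz : IsRelCorePoint D z) (hzS : z ∈ convexHull ℝ S) (hz0 : h z = 0)
    (hnonneg : ∀ x ∈ convexHull ℝ S ∩ D, h x = 0 → 0 ≤ φ x) :
    ∃ l : F →ₗ[ℝ] ℝ, ∀ x ∈ convexHull ℝ S ∩ D, 0 ≤ φ x + l (h x) := by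
  let := hS.fintype
  let L : (S → ℝ) →ₗ[ℝ] E := ∑ v : S, (LinearMap.proj v).smulRight v.1
  have hhull : ∀ x, x ∈ convexHull ℝ S ↔ ∃ w ∈ stdSimplex ℝ S, L w = x := by
    intro x
    rw [hS.convexHull_eq_image]
    rfl
  let coords : Set ((S → ℝ) →ᵃ[ℝ] ℝ) :=
    Set.range fun v => (LinearMap.proj v : (S → ℝ) →ₗ[ℝ] ℝ).toAffineMap
  let H : (S → ℝ) →ᵃ[ℝ] F × ℝ :=
    (h.comp L.toAffineMap).prod
      ((∑ v, LinearMap.proj v : (S → ℝ) →ₗ[ℝ] ℝ).toAffineMap - AffineMap.const ℝ _ 1)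
  have hH : ∀ w, H w = (h (L w), ∑ v, w v - 1) := fun w => by simp [H]
  have hcoords : ∀ {w : S → ℝ}, (∀ a ∈ coords, 0 ≤ a w) ↔ ∀ v, 0 ≤ w v :=
    Set.forall_mem_range
  obtain ⟨w₀, hw₀, rfl⟩ := (hhull z).1 hzS
  obtain ⟨l, p, hp, hle⟩ := hasMultipliers_of_isRelCorePoint hz.preimage (Set.finite_range _)
    (hcoords.2 hw₀.1) (hφ.comp_linearMap L) (h := H) (by simp [hH, hz0, hw₀.2])
    (fun w hw hHw hwpos => by
      rw [hH, Prod.mk_eq_zero, sub_eq_zero] at hHw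
      exact hnonneg (L w) ⟨(hhull _).2 ⟨w, ⟨hcoords.1 hwpos, hHw.2⟩, rfl⟩, hw⟩ hHw.1)
  refine ⟨l.comp (LinearMap.inl ℝ F ℝ), fun x hx => ?_⟩
  obtain ⟨w, hw, rfl⟩ := (hhull x).1 hx.1
  have hHw : H w = (h (L w), 0) := by rw [hH, hw.2, sub_self]
  calc 0 ≤ p w := nonneg_of_mem_pointedCone_hull (hcoords.2 hw.1) hp
    _ ≤ φ (L w) + l (H w) := hle w hx.2
    _ = φ (L w) + l.comp (LinearMap.inl ℝ F ℝ) (h (L w)) := by rw [hHw]; rfl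

end AffineInequalities

theorem convexOn_toReal {E : Type*} [AddCommGroup E] [Module ℝ E] {f : E → EReal}
    (hbot : ∀ x, f x ≠ ⊥) (hconv : Convex ℝ {p : E × ℝ | f p.1 ≤ (p.2 : EReal)}) :
    ConvexOn ℝ {x | f x ≠ ⊤} (fun x => (f x).toReal) := by
  rw [convexOn_iff_convex_epigraph]
  convert hconv using 3 with p
  constructor
  · rintro ⟨htop, hle⟩
    rwa [← EReal.coe_toReal htop (hbot p.1), EReal.coe_le_coe_iff]
  · intro hle
    have htop : f p.1 ≠ ⊤ := ne_top_of_le_ne_top (EReal.coe_ne_top _) hle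
    exact ⟨htop, by rwa [← EReal.coe_le_coe_iff, EReal.coe_toReal htop (hbot p.1)]⟩

theorem exists_isLeast_norm {V : Type*} [NormedAddCommGroup V] [ProperSpace V] {s : Set V}
    (hs : IsClosed s) (hne : s.Nonempty) : ∃ y ∈ s, IsLeast ((fun y => ‖y‖) '' s) ‖y‖ := by
  obtain ⟨y, hy, hdist⟩ := hs.exists_infDist_eq_dist hne 0
  refine ⟨y, hy, ⟨y, hy, rfl⟩, ?_⟩
  rintro _ ⟨z, hz, rfl⟩
  simpa only [hdist, dist_zero_left] using Metric.infDist_le_dist_of_mem (x := (0 : V)) hz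

namespace Problem

variable {n₁ n₂ m : ℕ} (P : Problem n₁ n₂ m)

/-- The part of the standing assumption that drives the convergence analysis: both blocks are
convex with values in `ℝ ∪ {+∞}`. Convexity of a function is that of its epigraph. -/
structure IsConvex : Prop where
  f₁_ne_bot : ∀ x, P.f₁ x ≠ ⊥
  f₂_ne_bot : ∀ x, P.f₂ x ≠ ⊥
  f₁_convex : Convex ℝ {p : Vec n₁ × ℝ | P.f₁ p.1 ≤ (p.2 : EReal)}
  f₂_convex : Convex ℝ {p : Vec n₂ × ℝ | P.f₂ p.1 ≤ (p.2 : EReal)}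
  X₁_convex : Convex ℝ P.X₁
  X₂_convex : Convex ℝ P.X₂

/-- The objective as a real-valued function; outside `P.dom` it takes junk values. -/
noncomputable def realObj (x : Vec n₁ × Vec n₂) : ℝ := (P.f₁ x.1).toReal + (P.f₂ x.2).toReal

/-- The residual as an affine map. -/
noncomputable def resAffine : Vec n₁ × Vec n₂ →ᵃ[ℝ] Vec m :=
  (P.A₁.coprod P.A₂).toLinearMap.toAffineMap - AffineMap.const ℝ _ P.b

theorem resAffine_apply (x : Vec n₁ × Vec n₂) : P.resAffine x = P.res x := by
  simp [resAffine, res]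

theorem dual_le_optVal (y : Vec m) : P.dual y ≤ P.optVal := by
  refine le_iInf₂ fun x hx => (iInf₂_le x hx.1).trans_eq ?_
  rw [hx.2, inner_zero_right, EReal.coe_zero, add_zero]

variable {P}

theorem dualVal_eq_optVal (hdual : ∃ y, P.optVal ≤ P.dual y) : P.dualVal = P.optVal :=
  let ⟨y, hy⟩ := hdual
  le_antisymm (iSup_le P.dual_le_optVal) (hy.trans (le_iSup _ y))

theorem mem_dualSolutions_iff (hdual : ∃ y, P.optVal ≤ P.dual y) {y : Vec m} :
    y ∈ P.dualSolutions ↔ P.optVal ≤ P.dual y :=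
  let ⟨y₀, hy₀⟩ := hdual
  ⟨fun h => hy₀.trans (h y₀), fun h z => (P.dual_le_optVal z).trans h⟩

theorem Standing.isConvex (hP : P.Standing) : P.IsConvex where
  f₁_ne_bot := hP.f₁_pcc.ne_bot
  f₂_ne_bot := hP.f₂_pcc.ne_bot
  f₁_convex := hP.f₁_pcc.convex
  f₂_convex := hP.f₂_pcc.convex
  X₁_convex := hP.X₁_convex
  X₂_convex := hP.X₂_convex

namespace IsConvex

theorem convex_X (hP : P.IsConvex) : Convex ℝ P.X := hP.X₁_convex.prod hP.X₂_convex

theorem obj_eq (hP : P.IsConvex) {x : Vec n₁ × Vec n₂} (hx : x ∈ P.dom) :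
    P.obj x = (P.realObj x : EReal) := by
  rw [obj, realObj, EReal.coe_add, EReal.coe_toReal hx.1 (hP.f₁_ne_bot _),
    EReal.coe_toReal hx.2 (hP.f₂_ne_bot _)]

theorem obj_eq_top_iff (hP : P.IsConvex) {x : Vec n₁ × Vec n₂} : P.obj x = ⊤ ↔ x ∉ P.dom := by
  rw [← not_iff_not, not_not, obj]
  exact EReal.add_ne_top_iff_ne_top₂ (hP.f₁_ne_bot _) (hP.f₂_ne_bot _)

theorem convexOn_realObj (hP : P.IsConvex) : ConvexOn ℝ P.dom P.realObj := by
  have hf₁ := (convexOn_toReal hP.f₁_ne_bot hP.f₁_convex).comp_linearMap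
    (LinearMap.fst ℝ (Vec n₁) (Vec n₂))
  have hf₂ := (convexOn_toReal hP.f₂_ne_bot hP.f₂_convex).comp_linearMap
    (LinearMap.snd ℝ (Vec n₁) (Vec n₂))
  have hdom : Convex ℝ P.dom := hf₁.1.inter hf₂.1
  exact (hf₁.subset Set.inter_subset_left hdom).add (hf₂.subset Set.inter_subset_right hdom)

theorem le_dual_iff (hP : P.IsConvex) {y : Vec m} {c : ℝ} :
    (c : EReal) ≤ P.dual y ↔ ∀ x ∈ P.X ∩ P.dom, c ≤ P.realObj x + inner ℝ y (P.res x) := by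
  rw [dual, le_iInf₂_iff]
  constructor
  · intro h x hx
    have hle := h x hx.1
    rwa [hP.obj_eq hx.2, ← EReal.coe_add, EReal.coe_le_coe_iff] at hle
  · intro h x hx
    by_cases hxd : x ∈ P.dom
    · rw [hP.obj_eq hxd, ← EReal.coe_add, EReal.coe_le_coe_iff]
      exact h x ⟨hx, hxd⟩
    · rw [hP.obj_eq_top_iff.2 hxd, EReal.top_add_of_ne_bot (EReal.coe_ne_bot _)]
      exact le_top

theorem le_realObj (hP : P.IsConvex) {c : ℝ} (hopt : (c : EReal) ≤ P.optVal)
    {x : Vec n₁ × Vec n₂} (hx : x ∈ P.feasible) (hxd : x ∈ P.dom) : c ≤ P.realObj x := by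
  rw [← EReal.coe_le_coe_iff, ← hP.obj_eq hxd]
  exact hopt.trans (iInf₂_le x hx)

theorem le_realObj_add_norm_mul_norm (hP : P.IsConvex) {c : ℝ} {y : Vec m}
    (hy : (c : EReal) ≤ P.dual y) {x : Vec n₁ × Vec n₂} (hx : x ∈ P.X ∩ P.dom) :
    c ≤ P.realObj x + ‖y‖ * ‖P.res x‖ :=
  (hP.le_dual_iff.1 hy x hx).trans (by gcongr; exact real_inner_le_norm y (P.res x))

theorem optVal_le_of_forall_le (hP : P.IsConvex) {c : EReal}
    (hc : ∀ x ∈ P.feasible, x ∈ P.dom → c ≤ P.realObj x) : c ≤ P.optVal := by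
  refine le_iInf₂ fun x hx => ?_
  by_cases hxd : x ∈ P.dom
  · rw [hP.obj_eq hxd]
    exact hc x hx hxd
  · rw [hP.obj_eq_top_iff.2 hxd]
    exact le_top

theorem nonempty_X_inter_dom (hP : P.IsConvex) (hopt : P.optVal ≠ ⊤) : (P.X ∩ P.dom).Nonempty := by
  by_contra! hempty
  refine hopt (top_le_iff.1 (hP.optVal_le_of_forall_le fun x hx hxd => ?_))
  exact absurd (hempty ▸ ⟨hx.1, hxd⟩ : x ∈ (∅ : Set _)) (Set.notMem_empty x)

theorem exists_le_dual_of_multiplier (hP : P.IsConvex) {c : ℝ}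
    (h : ∃ l : Vec m →ₗ[ℝ] ℝ, ∀ x ∈ P.X ∩ P.dom, 0 ≤ (P.realObj x + -c) + l (P.resAffine x)) :
    ∃ y, (c : EReal) ≤ P.dual y := by
  obtain ⟨l, hl⟩ := h
  refine ⟨(InnerProductSpace.toDual ℝ (Vec m)).symm l.toContinuousLinearMap,
    hP.le_dual_iff.2 fun x hx => ?_⟩
  have hlx := hl x hx
  rw [P.resAffine_apply] at hlx
  rw [InnerProductSpace.toDual_symm_apply, LinearMap.coe_toContinuousLinearMap']
  linarith

theorem exists_le_dual_of_polytope (hP : P.IsConvex) {c : ℝ} (hopt : (c : EReal) ≤ P.optVal)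
    {S : Set (Vec n₁ × Vec n₂)} (hS : S.Finite) (hX : P.X = convexHull ℝ S)
    {x₀ : Vec n₁ × Vec n₂} (hx₀ : x₀ ∈ P.feasible) (hx₀d : x₀ ∈ intrinsicInterior ℝ P.dom) :
    ∃ y, (c : EReal) ≤ P.dual y := by
  refine hP.exists_le_dual_of_multiplier ?_
  rw [hX]
  refine exists_multiplier_of_polytope hS (hP.convexOn_realObj.add_const (-c)) P.resAffine
    (isRelCorePoint_of_mem_intrinsicInterior hx₀d) (hX ▸ hx₀.1)
    (by rw [P.resAffine_apply]; exact hx₀.2) fun x hx hx0 => ?_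
  rw [← hX] at hx
  rw [P.resAffine_apply] at hx0
  simpa using hP.le_realObj hopt ⟨hx.1, hx0⟩ hx.2

theorem exists_le_dual_of_intrinsicInterior (hP : P.IsConvex) {c : ℝ}
    (hopt : (c : EReal) ≤ P.optVal) {x₀ : Vec n₁ × Vec n₂}
    (hx₀ : x₀ ∈ intrinsicInterior ℝ (P.X ∩ P.dom)) (hx₀0 : P.res x₀ = 0) :
    ∃ y, (c : EReal) ≤ P.dual y := by
  refine hP.exists_le_dual_of_multiplier ?_
  refine exists_multiplier_of_isRelCorePoint
    ((hP.convexOn_realObj.add_const (-c)).subset Set.inter_subset_right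
      (hP.convex_X.inter hP.convexOn_realObj.1)) P.resAffine
    (isRelCorePoint_of_mem_intrinsicInterior hx₀) (by rw [P.resAffine_apply]; exact hx₀0)
    fun x hx hx0 => ?_
  rw [P.resAffine_apply] at hx0
  simpa using hP.le_realObj hopt ⟨hx.1, hx0⟩ hx.2

theorem isClosed_setOf_le_dual (hP : P.IsConvex) (c : ℝ) :
    IsClosed {y | (c : EReal) ≤ P.dual y} := by
  simp only [hP.le_dual_iff, Set.ofPred_forall]
  exact isClosed_biInter fun x _ => isClosed_le continuous_const (by fun_prop)

theorem exists_isLeast_norm_dualSolutions (hP : P.IsConvex) {c : ℝ} (hopt : P.optVal = c)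
    (hdual : ∃ y, P.optVal ≤ P.dual y) :
    ∃ y ∈ P.dualSolutions, IsLeast ((fun y => ‖y‖) '' P.dualSolutions) ‖y‖ := by
  have hset : P.dualSolutions = {y | (c : EReal) ≤ P.dual y} := by
    ext y
    rw [mem_dualSolutions_iff hdual, hopt]
    rfl
  rw [hset]
  exact exists_isLeast_norm (hP.isClosed_setOf_le_dual c) (hopt ▸ hdual)

end IsConvex

theorem Standing.exists_optVal_eq (hP : P.Standing) : ∃ c : ℝ, P.optVal = c := by
  obtain ⟨z, hz, hztop, hzmin⟩ := hP.solvable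
  have hzd : z ∈ P.dom := not_not.1 (hztop ∘ hP.isConvex.obj_eq_top_iff.2)
  exact ⟨P.realObj z, by
    rw [← hP.isConvex.obj_eq hzd]
    exact le_antisymm (iInf₂_le z hz) (le_iInf₂ hzmin)⟩

theorem Standing.exists_optVal_le_dual (hP : P.Standing) : ∃ y, P.optVal ≤ P.dual y := by
  obtain ⟨c, hc⟩ := hP.exists_optVal_eq
  rw [hc]
  rcases hP.qualification with ⟨⟨S, hX⟩, x₀, hx₀, hx₀d⟩ | ⟨x₀, hx₀, hx₀0⟩
  · exact hP.isConvex.exists_le_dual_of_polytope hc.ge S.finite_toSet hX hx₀ hx₀d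
  · exact hP.isConvex.exists_le_dual_of_intrinsicInterior hc.ge hx₀ hx₀0

end Problem

section Schedule

variable {γ₀ : ℝ}

theorem tau_pos (k : ℕ) : 0 < tau k := by rw [tau]; positivity

theorem one_sub_tau (k : ℕ) : 1 - tau k = (k + 1) / (k + 4) := by
  rw [tau]; field_simp; ring

theorem one_sub_tau_pos (k : ℕ) : 0 < 1 - tau k := by rw [one_sub_tau]; positivity

theorem gam_pos (hγ : 0 < γ₀) (k : ℕ) : 0 < gam γ₀ k := by rw [gam]; positivity

theorem bet_pos (hγ : 0 < γ₀) (k : ℕ) : 0 < bet γ₀ k := by rw [bet]; positivity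

theorem rho_pos (hγ : 0 < γ₀) (k : ℕ) : 0 < rho γ₀ k := by rw [rho]; positivity

theorem eta_pos (hγ : 0 < γ₀) (k : ℕ) : 0 < eta γ₀ k := by rw [eta]; positivity

theorem gam_succ (γ₀ : ℝ) (k : ℕ) : gam γ₀ (k + 1) = 2 * γ₀ / (k + 3) := by
  rw [gam]; push_cast; ring_nf

theorem bet_le (hγ : 0 < γ₀) (k : ℕ) : bet γ₀ k ≤ 9 / γ₀ / (k + 2) := by
  have hk : (0 : ℝ) ≤ k := k.cast_nonneg
  rw [bet, div_div, div_le_div_iff₀ (by positivity) (by positivity)]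
  nlinarith [mul_nonneg hγ.le hk]

theorem one_sub_tau_mul_gam_le (hγ : 0 < γ₀) (k : ℕ) :
    (1 - tau k) * gam γ₀ k ≤ gam γ₀ (k + 1) := by
  rw [one_sub_tau, gam_succ, gam, div_mul_div_comm, div_le_div_iff₀ (by positivity) (by positivity)]
  have hdiff : (0 : ℝ) ≤ γ₀ * (2 * k + 5) := by positivity
  linarith

theorem one_sub_tau_mul_bet (hγ : 0 < γ₀) (k : ℕ) :
    (1 - tau k) * bet γ₀ k = 9 * (k + 3) / (γ₀ * (k + 4) * (k + 7)) := by
  rw [one_sub_tau, bet]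
  field_simp

theorem one_sub_tau_mul_bet_le (hγ : 0 < γ₀) (k : ℕ) :
    (1 - tau k) * bet γ₀ k ≤ bet γ₀ (k + 1) := by
  rw [one_sub_tau_mul_bet hγ, bet, div_le_div_iff₀ (by positivity) (by positivity)]
  push_cast
  have hdiff : (0 : ℝ) ≤ γ₀ * (2 * k ^ 2 + 26 * k + 64) := by positivity
  linarith

/-- The coefficient of the squared residual of the new iterate in the one-step estimate. -/
theorem residual_coeff_eq (hγ : 0 < γ₀) (k : ℕ) :
    tau k ^ 2 / (2 * ((1 - tau k) * bet γ₀ k)) + eta γ₀ k ^ 2 / gam γ₀ (k + 1) - eta γ₀ k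
      = 3 * γ₀ / (2 * (k + 3) * (k + 4)) := by
  rw [one_sub_tau_mul_bet hγ, gam_succ, eta, tau]
  field_simp
  ring

theorem error_recursion (hγ : 0 < γ₀) (k : ℕ) :
    (1 - tau k) * (3 * gam γ₀ k) + 3 * γ₀ / ((k + 3) * (k + 4))
      + 2 * rho γ₀ k ^ 2 / gam γ₀ (k + 1) ≤ 3 * gam γ₀ (k + 1) := by
  have hdiff : 3 * gam γ₀ (k + 1) - ((1 - tau k) * (3 * gam γ₀ k) + 3 * γ₀ / ((k + 3) * (k + 4))
      + 2 * rho γ₀ k ^ 2 / gam γ₀ (k + 1))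
      = γ₀ * (9 * k ^ 2 + 51 * k + 78) / ((k + 2) * (k + 3) * (k + 4) ^ 2) := by
    rw [one_sub_tau, gam_succ, gam, rho]
    field_simp
    ring
  exact sub_nonneg.1 (hdiff ▸ by positivity)

theorem error_step_le (hγ : 0 < γ₀) (k : ℕ) {D r q : ℝ} (hD : 0 ≤ D) (hr : r ≤ 2 * D)
    (hq : q ≤ 2 * D) :
    (1 - tau k) * (3 * gam γ₀ k * D)
      + (tau k ^ 2 / (2 * ((1 - tau k) * bet γ₀ k)) + eta γ₀ k ^ 2 / gam γ₀ (k + 1) - eta γ₀ k) * r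
      + rho γ₀ k ^ 2 / gam γ₀ (k + 1) * q ≤ 3 * gam γ₀ (k + 1) * D := by
  have hgam := gam_pos hγ (k + 1)
  rw [residual_coeff_eq hγ]
  calc _ ≤ (1 - tau k) * (3 * gam γ₀ k * D) + 3 * γ₀ / (2 * (k + 3) * (k + 4)) * (2 * D)
        + rho γ₀ k ^ 2 / gam γ₀ (k + 1) * (2 * D) := by gcongr
    _ = ((1 - tau k) * (3 * gam γ₀ k) + 3 * γ₀ / ((k + 3) * (k + 4))
        + 2 * rho γ₀ k ^ 2 / gam γ₀ (k + 1)) * D := by field_simp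
    _ ≤ 3 * gam γ₀ (k + 1) * D := mul_le_mul_of_nonneg_right (error_recursion hγ k) hD

theorem gam_one_le (hγ : 0 < γ₀) : gam γ₀ 1 ≤ gam γ₀ 0 := by
  rw [gam, gam]
  push_cast
  linarith

theorem inv_bet_zero_add_le (hγ : 0 < γ₀) :
    1 / (2 * bet γ₀ 0) + eta γ₀ 0 ^ 2 / gam γ₀ 1 ≤ eta γ₀ 0 := by
  have hdiff : eta γ₀ 0 - (1 / (2 * bet γ₀ 0) + eta γ₀ 0 ^ 2 / gam γ₀ 1) = γ₀ / 27 := by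
    rw [bet, eta, gam]
    push_cast
    field_simp
    norm_num
  exact sub_nonneg.1 (hdiff ▸ by positivity)

theorem rho_zero_sq_div_le (hγ : 0 < γ₀) : 2 * (rho γ₀ 0 ^ 2 / gam γ₀ 1) ≤ 3 * gam γ₀ 0 := by
  have hdiff : 3 * gam γ₀ 0 - 2 * (rho γ₀ 0 ^ 2 / gam γ₀ 1) = 45 / 16 * γ₀ := by
    rw [rho, gam, gam]
    push_cast
    field_simp
    norm_num
  exact sub_nonneg.1 (hdiff ▸ by positivity)

theorem penalty_nonneg (hγ : 0 < γ₀) (k : ℕ) (r : ℝ) : 0 ≤ 1 / (2 * bet γ₀ k) * r ^ 2 := by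
  have hbet := bet_pos hγ k
  positivity

theorem le_add_of_sq_le {a b r : ℝ} (ha : 0 ≤ a) (hb : 0 ≤ b) (h : r ^ 2 ≤ a * r + b ^ 2) :
    r ≤ a + b := by
  by_contra! hlt
  nlinarith [mul_nonneg ha hb]

theorem le_of_penalty_le {β d s c t r : ℝ} (hγ : 0 < γ₀) (hβ : 0 < β) (hd : 0 ≤ d)
    (hc : 0 ≤ c) (ht : 0 < t) (hr : 0 ≤ r) (hβt : β ≤ 9 / γ₀ / t) (hs : s ≤ 2 * γ₀ * c / t)
    (h : 1 / (2 * β) * r ^ 2 ≤ d * r + s) : r ≤ 6 * (3 * d / γ₀ + √c) / t := by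
  have hsq : r ^ 2 ≤ 2 * (9 / γ₀ / t) * (d * r + 2 * γ₀ * c / t) :=
    calc r ^ 2 = 2 * β * (1 / (2 * β) * r ^ 2) := by field_simp
      _ ≤ 2 * β * (d * r + 2 * γ₀ * c / t) := by
        gcongr
        exact h.trans (by gcongr)
      _ ≤ 2 * (9 / γ₀ / t) * (d * r + 2 * γ₀ * c / t) := by gcongr
  have hscaled : (t * r) ^ 2 ≤ 18 * d / γ₀ * (t * r) + (6 * √c) ^ 2 :=
    calc (t * r) ^ 2 = t ^ 2 * r ^ 2 := mul_pow t r 2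
      _ ≤ t ^ 2 * (2 * (9 / γ₀ / t) * (d * r + 2 * γ₀ * c / t)) := by gcongr
      _ = 18 * d / γ₀ * (t * r) + (6 * √c) ^ 2 := by
        rw [mul_pow, Real.sq_sqrt hc]
        field_simp
        ring
  rw [le_div_iff₀ ht, mul_comm r t]
  exact (le_add_of_sq_le (by positivity) (by positivity) hscaled).trans_eq (by ring)

end Schedule

section Minimizers

theorem ne_top_of_isMinOn_add {α : Type*} {f : α → EReal} {q : α → ℝ} {X : Set α} {x z : α}
    (hz : z ∈ X) (hz_top : f z ≠ ⊤) (hmin : IsMinOn (fun u => f u + (q u : EReal)) X x) :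
    f x ≠ ⊤ := by
  intro hx
  have hle : f x + q x ≤ f z + q z := hmin hz
  rw [hx, EReal.top_add_of_ne_bot (EReal.coe_ne_bot _)] at hle
  exact EReal.add_ne_top hz_top (EReal.coe_ne_top _) (top_le_iff.1 hle)

theorem toReal_add_le_of_isMinOn_add {α : Type*} {f : α → EReal} {q : α → ℝ} {X : Set α}
    {x u : α} (hbot : ∀ z, f z ≠ ⊥) (hx : f x ≠ ⊤)
    (hmin : IsMinOn (fun u => f u + (q u : EReal)) X x) (hu : u ∈ X) (hu_top : f u ≠ ⊤) :
    (f x).toReal + q x ≤ (f u).toReal + q u := by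
  have hle : f x + q x ≤ f u + q u := hmin hu
  rwa [← EReal.coe_toReal hx (hbot x), ← EReal.coe_toReal hu_top (hbot u), ← EReal.coe_add,
    ← EReal.coe_add, EReal.coe_le_coe_iff] at hle

theorem nonneg_of_forall_add_mul_nonneg {a M : ℝ} (h : ∀ t, 0 < t → t < 1 → 0 ≤ a + t * M) :
    0 ≤ a := by
  have hlim : Filter.Tendsto (fun t : ℝ => a + t * M) (nhdsWithin 0 (Set.Ioi 0)) (nhds a) := by
    have hcont : Continuous fun t : ℝ => a + t * M := by fun_prop
    simpa using (hcont.tendsto 0).mono_left nhdsWithin_le_nhds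
  refine ge_of_tendsto hlim ?_
  filter_upwards [Ioo_mem_nhdsGT (zero_lt_one' ℝ)] with t ht using h t ht.1 ht.2

/-- First-order optimality; `g` plays the role of the derivative of `q` at `x` towards `u`. -/
theorem le_add_of_forall_add_le {E : Type*} [AddCommGroup E] [Module ℝ E] {C : Set E}
    {φ q : E → ℝ} (hφ : ConvexOn ℝ C φ) {x u : E} (hx : x ∈ C) (hu : u ∈ C) {g M : ℝ}
    (hq : ∀ t : ℝ, q ((1 - t) • x + t • u) = q x + t * g + t ^ 2 * M)
    (hmin : ∀ v ∈ C, φ x + q x ≤ φ v + q v) : φ x ≤ φ u + g := by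
  suffices h : 0 ≤ φ u + g - φ x by linarith
  refine nonneg_of_forall_add_mul_nonneg (M := M) fun t ht ht1 => ?_
  have h1t : 0 ≤ 1 - t := by linarith
  have hle := hmin _ (hφ.1 hx hu h1t ht.le (by ring))
  have hconv := hφ.2 hx hu h1t ht.le (by ring)
  rw [hq] at hle
  rw [smul_eq_mul, smul_eq_mul] at hconv
  exact nonneg_of_mul_nonneg_right (by linarith : 0 ≤ t * (φ u + g - φ x + t * M)) ht

theorem toReal_le_add_of_isMinOn_add {E : Type*} [AddCommGroup E] [Module ℝ E] {f : E → EReal}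
    {q : E → ℝ} {X : Set E} (hbot : ∀ z, f z ≠ ⊥)
    (hconv : Convex ℝ {p : E × ℝ | f p.1 ≤ (p.2 : EReal)}) (hX : Convex ℝ X) {x u : E}
    (hx : x ∈ X) (hmin : IsMinOn (fun u => f u + (q u : EReal)) X x) (hu : u ∈ X)
    (hu_top : f u ≠ ⊤) {g M : ℝ}
    (hq : ∀ t : ℝ, q ((1 - t) • x + t • u) = q x + t * g + t ^ 2 * M) :
    (f x).toReal ≤ (f u).toReal + g := by
  have hx_top := ne_top_of_isMinOn_add hu hu_top hmin
  have hf := convexOn_toReal hbot hconv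
  exact le_add_of_forall_add_le (hf.subset Set.inter_subset_right (hX.inter hf.1))
    ⟨hx, hx_top⟩ ⟨hu, hu_top⟩ hq
    fun v hv => toReal_add_le_of_isMinOn_add hbot hx_top hmin hv.1 hv.2

end Minimizers

section InnerProduct

variable {V : Type*} [NormedAddCommGroup V] [InnerProductSpace ℝ V]

theorem norm_smul_add_smul_sq (a b : ℝ) (v w : V) :
    ‖a • v + b • w‖ ^ 2 = a ^ 2 * ‖v‖ ^ 2 + 2 * (a * b) * inner ℝ v w + b ^ 2 * ‖w‖ ^ 2 := by
  rw [norm_add_sq_real, norm_smul, norm_smul, mul_pow, mul_pow, inner_smul_left, inner_smul_right,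
    Real.norm_eq_abs, Real.norm_eq_abs, sq_abs, sq_abs, conj_trivial]
  ring

theorem norm_lineMap_sq (v w : V) (t : ℝ) :
    ‖(1 - t) • v + t • w‖ ^ 2 =
      ‖v‖ ^ 2 + t * (2 * inner ℝ v (w - v)) + t ^ 2 * ‖w - v‖ ^ 2 := by
  have hcombo : (1 - t) • v + t • w = (1 : ℝ) • v + t • (w - v) := by module
  rw [hcombo, norm_smul_add_smul_sq]
  ring

theorem inner_le_young {γ : ℝ} (hγ : 0 < γ) (v w : V) :
    inner ℝ v w ≤ γ / 4 * ‖w‖ ^ 2 + ‖v‖ ^ 2 / γ := by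
  have hsq : 0 ≤ ‖(1 : ℝ) • v + (-(γ / 2)) • w‖ ^ 2 / γ := by positivity
  rw [norm_smul_add_smul_sq] at hsq
  have hexpand : (1 ^ 2 * ‖v‖ ^ 2 + 2 * (1 * -(γ / 2)) * inner ℝ v w
      + (-(γ / 2)) ^ 2 * ‖w‖ ^ 2) / γ = γ / 4 * ‖w‖ ^ 2 + ‖v‖ ^ 2 / γ - inner ℝ v w := by
    field_simp
    ring
  linarith

theorem inner_smul_sub_smul_le {γ : ℝ} (hγ : 0 < γ) (ρ η : ℝ) (q r d : V) :
    inner ℝ (ρ • q - η • r) d ≤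
      γ / 2 * ‖d‖ ^ 2 + (η ^ 2 / γ * ‖r‖ ^ 2 + ρ ^ 2 / γ * ‖q‖ ^ 2) := by
  have hq := inner_le_young hγ (ρ • q) d
  have hr := inner_le_young hγ (-(η • r)) d
  rw [norm_neg] at hr
  rw [norm_smul, mul_pow, Real.norm_eq_abs, sq_abs] at hq hr
  rw [sub_eq_add_neg, inner_add_left]
  linarith [mul_div_right_comm (ρ ^ 2) (‖q‖ ^ 2) γ, mul_div_right_comm (η ^ 2) (‖r‖ ^ 2) γ]

theorem penalty_combo_le {σ τ β β' : ℝ} (hσ : 0 < σ) (hβ : 0 < β) (hβ' : σ * β ≤ β') (v w : V) :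
    1 / (2 * β') * ‖σ • v + τ • w‖ ^ 2 ≤
      σ * (1 / (2 * β) * ‖v‖ ^ 2) + τ * β⁻¹ * inner ℝ v w + τ ^ 2 / (2 * (σ * β)) * ‖w‖ ^ 2 :=
  calc 1 / (2 * β') * ‖σ • v + τ • w‖ ^ 2
    _ ≤ 1 / (2 * (σ * β)) * ‖σ • v + τ • w‖ ^ 2 := by gcongr
    _ = σ * (1 / (2 * β) * ‖v‖ ^ 2) + τ * β⁻¹ * inner ℝ v w
        + τ ^ 2 / (2 * (σ * β)) * ‖w‖ ^ 2 := by
      rw [norm_smul_add_smul_sq]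
      field_simp

end InnerProduct

namespace Problem

variable {n₁ n₂ m : ℕ} {P : Problem n₁ n₂ m} {xc : Vec n₁}

theorem norm_res_sq_le (hbdd : BddAbove ((fun x => ‖P.res x‖ ^ 2) '' P.X))
    {x : Vec n₁ × Vec n₂} (hx : x ∈ P.X) : ‖P.res x‖ ^ 2 ≤ 2 * P.DA := by
  have hle : ‖P.res x‖ ^ 2 ≤ sSup ((fun x => ‖P.res x‖ ^ 2) '' P.X) := le_csSup hbdd ⟨x, hx, rfl⟩
  rw [DA]
  linarith

theorem DA_nonneg (P : Problem n₁ n₂ m) : 0 ≤ P.DA :=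
  mul_nonneg (by norm_num) (Real.sSup_nonneg (by rintro _ ⟨x, _, rfl⟩; positivity))

theorem D₁_nonneg (P : Problem n₁ n₂ m) (xc : Vec n₁) : 0 ≤ P.D₁ xc :=
  mul_nonneg (by norm_num) (Real.sSup_nonneg (by rintro _ ⟨x, _, rfl⟩; positivity))

theorem bddAbove_norm_sub_sq (hbdd : BddAbove ((fun x => ‖P.res x‖ ^ 2) '' P.X)) {z₂ : Vec n₂}
    (hz₂ : z₂ ∈ P.X₂) (hxc : xc ∈ P.X₁) :
    BddAbove ((fun x₁ => ‖P.A₁ (x₁ - xc)‖ ^ 2) '' P.X₁) := by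
  refine ⟨8 * P.DA, ?_⟩
  rintro _ ⟨u, hu, rfl⟩
  have hdiff : P.A₁ (u - xc) = P.res (u, z₂) - P.res (xc, z₂) := by
    simp only [res, map_sub]
    abel
  have hpar := parallelogram_law_with_norm ℝ (P.res (u, z₂)) (P.res (xc, z₂))
  have hru := norm_res_sq_le hbdd (x := (u, z₂)) ⟨hu, hz₂⟩
  have hrc := norm_res_sq_le hbdd (x := (xc, z₂)) ⟨hxc, hz₂⟩
  change ‖P.A₁ (u - xc)‖ ^ 2 ≤ 8 * P.DA
  rw [hdiff]
  linarith [mul_self_nonneg ‖P.res (u, z₂) + P.res (xc, z₂)‖, sq ‖P.res (u, z₂) - P.res (xc, z₂)‖]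

theorem half_norm_sq_le_D₁ (hbdd : BddAbove ((fun x => ‖P.res x‖ ^ 2) '' P.X))
    (hxc : xc ∈ P.X₁) {u : Vec n₁ × Vec n₂} (hu : u ∈ P.X) :
    1 / 2 * ‖P.A₁ (u.1 - xc)‖ ^ 2 ≤ P.D₁ xc :=
  mul_le_mul_of_nonneg_left
    (le_csSup (bddAbove_norm_sub_sq hbdd hu.2 hxc) ⟨u.1, hu.1, rfl⟩) (by norm_num)

theorem res_combo (P : Problem n₁ n₂ m) (x y : Vec n₁ × Vec n₂) {a b : ℝ} (hab : a + b = 1) :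
    P.res (a • x + b • y) = a • P.res x + b • P.res y := by
  simp only [← P.resAffine_apply]
  exact Convex.combo_affine_apply hab

end Problem

variable {P : Problem n₁ n₂ m} {γ₀ : ℝ} {xc : Vec n₁}

namespace IsBlockStep

variable {k : ℕ} {yh y : Vec m} {z₂ : Vec n₂} {x : Vec n₁ × Vec n₂}

theorem mem (h : IsBlockStep P γ₀ xc k yh z₂ x y) (hne : (P.X ∩ P.dom).Nonempty) :
    x ∈ P.X ∩ P.dom :=
  let ⟨_, hz, hzd⟩ := hne
  ⟨⟨h.mem₁, h.mem₂⟩, ne_top_of_isMinOn_add hz.1 hzd.1 h.min₁,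
    ne_top_of_isMinOn_add hz.2 hzd.2 h.min₂⟩

theorem fst_le (h : IsBlockStep P γ₀ xc k yh z₂ x y) (hP : P.IsConvex) (hγ : 0 < γ₀)
    {u₁ : Vec n₁} (hu : u₁ ∈ P.X₁) (hu_top : P.f₁ u₁ ≠ ⊤) :
    (P.f₁ x.1).toReal ≤ (P.f₁ u₁).toReal
      + (gam γ₀ (k + 1) * inner ℝ (P.A₁ (x.1 - xc)) (P.A₁ u₁ - P.A₁ x.1)
        + inner ℝ (y + (rho γ₀ k • P.res (x.1, z₂) - eta γ₀ k • P.res x))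
          (P.A₁ u₁ - P.A₁ x.1)) := by
  have hmult : y + (rho γ₀ k • P.res (x.1, z₂) - eta γ₀ k • P.res x)
      = rho γ₀ k • (P.A₁ x.1 + P.A₂ z₂ - P.b + (rho γ₀ k)⁻¹ • yh) := by
    rw [h.dual_eq, smul_add, smul_inv_smul₀ (rho_pos hγ k).ne', Problem.res]
    abel
  rw [hmult, real_inner_smul_left]
  refine toReal_le_add_of_isMinOn_add hP.f₁_ne_bot hP.f₁_convex hP.X₁_convex h.mem₁ h.min₁ hu
    hu_top (M := gam γ₀ (k + 1) / 2 * ‖P.A₁ u₁ - P.A₁ x.1‖ ^ 2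
      + rho γ₀ k / 2 * ‖P.A₁ u₁ - P.A₁ x.1‖ ^ 2) fun t => ?_
  have hcenter : P.A₁ ((1 - t) • x.1 + t • u₁ - xc)
      = (1 - t) • P.A₁ (x.1 - xc) + t • P.A₁ (u₁ - xc) := by
    simp only [map_sub, map_add, map_smul]
    module
  have hres : P.A₁ ((1 - t) • x.1 + t • u₁) + P.A₂ z₂ - P.b + (rho γ₀ k)⁻¹ • yh
      = (1 - t) • (P.A₁ x.1 + P.A₂ z₂ - P.b + (rho γ₀ k)⁻¹ • yh)
        + t • (P.A₁ u₁ + P.A₂ z₂ - P.b + (rho γ₀ k)⁻¹ • yh) := by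
    simp only [map_add, map_smul]
    module
  have hdiff : P.A₁ (u₁ - xc) - P.A₁ (x.1 - xc) = P.A₁ u₁ - P.A₁ x.1 := by
    rw [← map_sub, sub_sub_sub_cancel_right, map_sub]
  rw [hcenter, hres, norm_lineMap_sq, norm_lineMap_sq, hdiff, add_sub_add_right_eq_sub,
    sub_sub_sub_cancel_right, add_sub_add_right_eq_sub]
  ring

theorem snd_le (h : IsBlockStep P γ₀ xc k yh z₂ x y) (hP : P.IsConvex) (hγ : 0 < γ₀)
    {u₂ : Vec n₂} (hu : u₂ ∈ P.X₂) (hu_top : P.f₂ u₂ ≠ ⊤) :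
    (P.f₂ x.2).toReal ≤ (P.f₂ u₂).toReal + inner ℝ y (P.A₂ u₂ - P.A₂ x.2) := by
  have hmult : y = eta γ₀ k • (P.A₁ x.1 + P.A₂ x.2 - P.b + (eta γ₀ k)⁻¹ • yh) := by
    rw [h.dual_eq, smul_add, smul_inv_smul₀ (eta_pos hγ k).ne', Problem.res, add_comm]
  rw [hmult, real_inner_smul_left]
  refine toReal_le_add_of_isMinOn_add hP.f₂_ne_bot hP.f₂_convex hP.X₂_convex h.mem₂ h.min₂ hu
    hu_top (M := eta γ₀ k / 2 * ‖P.A₂ u₂ - P.A₂ x.2‖ ^ 2) fun t => ?_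
  have hres : P.A₁ x.1 + P.A₂ ((1 - t) • x.2 + t • u₂) - P.b + (eta γ₀ k)⁻¹ • yh
      = (1 - t) • (P.A₁ x.1 + P.A₂ x.2 - P.b + (eta γ₀ k)⁻¹ • yh)
        + t • (P.A₁ x.1 + P.A₂ u₂ - P.b + (eta γ₀ k)⁻¹ • yh) := by
    simp only [map_add, map_smul]
    module
  rw [hres, norm_lineMap_sq, add_sub_add_right_eq_sub, sub_sub_sub_cancel_right,
    add_sub_add_left_eq_sub]
  ring

theorem lagrangian_bound (h : IsBlockStep P γ₀ xc k yh z₂ x y) (hP : P.IsConvex) (hγ : 0 < γ₀)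
    {u : Vec n₁ × Vec n₂} (hu : u ∈ P.X ∩ P.dom) :
    P.realObj x + inner ℝ y (P.res x) + gam γ₀ (k + 1) / 2 * ‖P.A₁ (x.1 - xc)‖ ^ 2 ≤
      P.realObj u + inner ℝ y (P.res u) + gam γ₀ (k + 1) / 2 * ‖P.A₁ (u.1 - xc)‖ ^ 2
        + (eta γ₀ k ^ 2 / gam γ₀ (k + 1) * ‖P.res x‖ ^ 2
          + rho γ₀ k ^ 2 / gam γ₀ (k + 1) * ‖P.res (x.1, z₂)‖ ^ 2) := by
  have h₁ := h.fst_le hP hγ hu.1.1 hu.2.1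
  have h₂ := h.snd_le hP hγ hu.1.2 hu.2.2
  have hyoung := inner_smul_sub_smul_le (gam_pos hγ (k + 1)) (rho γ₀ k) (eta γ₀ k)
    (P.res (x.1, z₂)) (P.res x) (P.A₁ u.1 - P.A₁ x.1)
  have hres : P.res u = P.res x + (P.A₁ u.1 - P.A₁ x.1) + (P.A₂ u.2 - P.A₂ x.2) := by
    simp only [Problem.res]
    abel
  have hcenter : P.A₁ (u.1 - xc) = P.A₁ (x.1 - xc) + (P.A₁ u.1 - P.A₁ x.1) := by
    simp only [map_sub]
    abel
  rw [inner_add_left] at h₁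
  rw [hres, hcenter, inner_add_right, inner_add_right, norm_add_sq_real, Problem.realObj,
    Problem.realObj]
  linarith

end IsBlockStep

/-- The excessive gap condition: the objective at `x`, penalized quadratically with parameter `β`,
exceeds the dual function at `y`, smoothed by the proximity term with parameter `γ`, by at most
`e`. The infimum defining the smoothed dual function is spelled out as a quantifier over `u`. -/
def SmoothedGapLE (P : Problem n₁ n₂ m) (xc : Vec n₁) (β γ e : ℝ) (x : Vec n₁ × Vec n₂)
    (y : Vec m) : Prop :=
  ∀ u ∈ P.X ∩ P.dom, P.realObj x + 1 / (2 * β) * ‖P.res x‖ ^ 2 ≤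
    P.realObj u + inner ℝ y (P.res u) + γ / 2 * ‖P.A₁ (u.1 - xc)‖ ^ 2 + e

namespace IsBlockStep

variable {yh y : Vec m} {z₂ : Vec n₂} {x : Vec n₁ × Vec n₂}

theorem smoothedGapLE_zero (h : IsBlockStep P γ₀ xc 0 0 z₂ x y) (hP : P.IsConvex) (hγ : 0 < γ₀)
    (hbdd : BddAbove ((fun x => ‖P.res x‖ ^ 2) '' P.X)) (hz₂ : z₂ ∈ P.X₂) :
    SmoothedGapLE P xc (bet γ₀ 0) (gam γ₀ 0) (3 * gam γ₀ 0 * P.DA) x y := by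
  intro u hu
  have hbound := h.lagrangian_bound hP hγ hu
  have hy : inner ℝ y (P.res x) = eta γ₀ 0 * ‖P.res x‖ ^ 2 := by
    rw [h.dual_eq, zero_add, real_inner_smul_left, real_inner_self_eq_norm_sq]
  have hgam := gam_pos hγ 1
  have hprox : gam γ₀ 1 / 2 * ‖P.A₁ (u.1 - xc)‖ ^ 2 ≤ gam γ₀ 0 / 2 * ‖P.A₁ (u.1 - xc)‖ ^ 2 := by
    gcongr
    exact gam_one_le hγ
  have hres := mul_le_mul_of_nonneg_right (inv_bet_zero_add_le hγ) (sq_nonneg ‖P.res x‖)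
  have herr : rho γ₀ 0 ^ 2 / gam γ₀ 1 * ‖P.res (x.1, z₂)‖ ^ 2 ≤ 3 * gam γ₀ 0 * P.DA :=
    calc _ ≤ rho γ₀ 0 ^ 2 / gam γ₀ 1 * (2 * P.DA) := by
          gcongr
          exact Problem.norm_res_sq_le hbdd ⟨h.mem₁, hz₂⟩
      _ = 2 * (rho γ₀ 0 ^ 2 / gam γ₀ 1) * P.DA := by ring
      _ ≤ 3 * gam γ₀ 0 * P.DA := mul_le_mul_of_nonneg_right (rho_zero_sq_div_le hγ) P.DA_nonneg
  have hdrop : 0 ≤ gam γ₀ 1 / 2 * ‖P.A₁ (x.1 - xc)‖ ^ 2 := by positivity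
  rw [hy, zero_add] at hbound
  linarith

variable {k : ℕ} {xb : Vec n₁ × Vec n₂} {yb : Vec m}

theorem inner_res_eq (h : IsBlockStep P γ₀ xc k yh z₂ x y)
    (hyh : yh = (1 - tau k) • yb + (tau k * (bet γ₀ k)⁻¹) • P.res xb) :
    inner ℝ y (P.res x) = (1 - tau k) * inner ℝ yb (P.res x)
      + tau k * (bet γ₀ k)⁻¹ * inner ℝ (P.res xb) (P.res x) + eta γ₀ k * ‖P.res x‖ ^ 2 := by
  rw [h.dual_eq, hyh, inner_add_left, inner_add_left, real_inner_smul_left, real_inner_smul_left,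
    real_inner_smul_left, real_inner_self_eq_norm_sq]

theorem smoothedGapLE_succ (h : IsBlockStep P γ₀ xc k yh z₂ x y) (hP : P.IsConvex) (hγ : 0 < γ₀)
    (hbdd : BddAbove ((fun x => ‖P.res x‖ ^ 2) '' P.X)) (hz₂ : z₂ ∈ P.X₂)
    (hxb : xb ∈ P.X ∩ P.dom)
    (hyh : yh = (1 - tau k) • yb + (tau k * (bet γ₀ k)⁻¹) • P.res xb)
    (hgap : SmoothedGapLE P xc (bet γ₀ k) (gam γ₀ k) (3 * gam γ₀ k * P.DA) xb yb) :
    SmoothedGapLE P xc (bet γ₀ (k + 1)) (gam γ₀ (k + 1)) (3 * gam γ₀ (k + 1) * P.DA)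
      ((1 - tau k) • xb + tau k • x) y := by
  intro u hu
  have hx := h.mem ⟨xb, hxb⟩
  have hτ := one_sub_tau_pos k
  have hbound := h.lagrangian_bound hP hγ hu
  have hgap_x := mul_le_mul_of_nonneg_left (hgap x hx) hτ.le
  have hconv : P.realObj ((1 - tau k) • xb + tau k • x)
      ≤ (1 - tau k) * P.realObj xb + tau k * P.realObj x :=
    hP.convexOn_realObj.2 hxb.2 hx.2 hτ.le (tau_pos k).le (by ring)
  have hpen := penalty_combo_le (τ := tau k) hτ (bet_pos hγ k) (one_sub_tau_mul_bet_le hγ k)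
    (P.res xb) (P.res x)
  have hprox := mul_le_mul_of_nonneg_right (one_sub_tau_mul_gam_le hγ k)
    (by positivity : 0 ≤ 1 / 2 * ‖P.A₁ (x.1 - xc)‖ ^ 2)
  have herr := error_step_le hγ k P.DA_nonneg (Problem.norm_res_sq_le hbdd hx.1)
    (Problem.norm_res_sq_le hbdd (x := (x.1, z₂)) ⟨h.mem₁, hz₂⟩)
  rw [h.inner_res_eq hyh] at hbound
  rw [P.res_combo _ _ (by ring)]
  linarith

end IsBlockStep

namespace IsRun

variable {x xb : ℕ → Vec n₁ × Vec n₂} {yh yb : ℕ → Vec m}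

theorem mem (h : IsRun P γ₀ xc x xb yh yb) (hP : P.IsConvex) (hne : (P.X ∩ P.dom).Nonempty)
    (k : ℕ) : xb k ∈ P.X ∩ P.dom := by
  induction k with
  | zero =>
    obtain ⟨z₂, -, hstart⟩ := h.start
    exact hstart.mem hne
  | succ k ih =>
    rw [h.xb_eq]
    exact (hP.convex_X.inter hP.convexOn_realObj.1) ih ((h.step k).mem hne)
      (one_sub_tau_pos k).le (tau_pos k).le (by ring)

theorem snd_mem (h : IsRun P γ₀ xc x xb yh yb) : ∀ k, (x k).2 ∈ P.X₂
  | 0 => h.init_mem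
  | k + 1 => (h.step k).mem₂

theorem smoothedGapLE (h : IsRun P γ₀ xc x xb yh yb) (hP : P.IsConvex)
    (hne : (P.X ∩ P.dom).Nonempty) (hγ : 0 < γ₀)
    (hbdd : BddAbove ((fun x => ‖P.res x‖ ^ 2) '' P.X)) (k : ℕ) :
    SmoothedGapLE P xc (bet γ₀ k) (gam γ₀ k) (3 * gam γ₀ k * P.DA) (xb k) (yb k) := by
  induction k with
  | zero =>
    obtain ⟨z₂, hz₂, hstart⟩ := h.start
    exact hstart.smoothedGapLE_zero hP hγ hbdd hz₂
  | succ k ih =>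
    rw [h.xb_eq]
    exact (h.step k).smoothedGapLE_succ hP hγ hbdd (h.snd_mem k) (h.mem hP hne k) (h.yh_eq k) ih

end IsRun

namespace Problem

variable {n₁ n₂ m : ℕ} (P : Problem n₁ n₂ m) (γ₀ : ℝ) (xc : Vec n₁) (DY : ℝ)

/-- The constant of the feasibility rate for an arbitrary value of `γ₀`, where `DY` is the norm of
a dual solution; at `γ₀ = 3` it is `DY + √(D₁ + 4 DA)`. -/
noncomputable def resBound : ℝ := 3 * DY / γ₀ + √(P.D₁ xc + 4 * P.DA)

/-- The constant of the objective rate for an arbitrary value of `γ₀`; at `γ₀ = 3` it is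
`P.Dmax xc DY`. -/
noncomputable def objBound : ℝ :=
  max (γ₀ / 3 * (P.D₁ xc + 3 * P.DA)) (DY * P.resBound γ₀ xc DY)

theorem smoothing_error_le (k : ℕ) :
    2 * γ₀ * (P.D₁ xc + 3 * P.DA) / (k + 2) ≤ 6 * P.objBound γ₀ xc DY / (k + 2) :=
  calc 2 * γ₀ * (P.D₁ xc + 3 * P.DA) / (k + 2)
    _ = 6 * (γ₀ / 3 * (P.D₁ xc + 3 * P.DA)) / (k + 2) := by ring
    _ ≤ 6 * P.objBound γ₀ xc DY / (k + 2) := by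
      gcongr
      exact le_max_left _ _

end Problem

namespace IsRun

variable {x xb : ℕ → Vec n₁ × Vec n₂} {yh yb : ℕ → Vec m}

theorem realObj_add_penalty_le (h : IsRun P γ₀ xc x xb yh yb) (hP : P.IsConvex) (hγ : 0 < γ₀)
    (hbdd : BddAbove ((fun x => ‖P.res x‖ ^ 2) '' P.X)) (k : ℕ) {u : Vec n₁ × Vec n₂}
    (hu : u ∈ P.X ∩ P.dom) :
    P.realObj (xb k) + 1 / (2 * bet γ₀ k) * ‖P.res (xb k)‖ ^ 2 ≤
      P.realObj u + inner ℝ (yb k) (P.res u) + 2 * γ₀ * (P.D₁ xc + 3 * P.DA) / (k + 2) := by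
  have hgap := h.smoothedGapLE hP ⟨u, hu⟩ hγ hbdd k u hu
  have hprox := mul_le_mul_of_nonneg_left
    (Problem.half_norm_sq_le_D₁ hbdd h.center_mem hu.1) (gam_pos hγ k).le
  have herr : gam γ₀ k * P.D₁ xc + 3 * gam γ₀ k * P.DA
      = 2 * γ₀ * (P.D₁ xc + 3 * P.DA) / (k + 2) := by
    rw [gam]
    ring
  linarith

variable {c : ℝ}

theorem realObj_add_penalty_le_optVal (h : IsRun P γ₀ xc x xb yh yb) (hP : P.IsConvex)
    (hγ : 0 < γ₀) (hbdd : BddAbove ((fun x => ‖P.res x‖ ^ 2) '' P.X)) (hopt : P.optVal = c)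
    (k : ℕ) :
    P.realObj (xb k) + 1 / (2 * bet γ₀ k) * ‖P.res (xb k)‖ ^ 2 ≤
      c + 2 * γ₀ * (P.D₁ xc + 3 * P.DA) / (k + 2) := by
  rw [← sub_le_iff_le_add, ← EReal.coe_le_coe_iff, ← hopt]
  refine hP.optVal_le_of_forall_le fun u hu hud => EReal.coe_le_coe_iff.2 ?_
  have hle := h.realObj_add_penalty_le hP hγ hbdd k ⟨hu.1, hud⟩
  rw [hu.2, inner_zero_right] at hle
  linarith

theorem mem_of_optVal_eq (h : IsRun P γ₀ xc x xb yh yb) (hP : P.IsConvex) (hopt : P.optVal = c)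
    (k : ℕ) : xb k ∈ P.X ∩ P.dom :=
  h.mem hP (hP.nonempty_X_inter_dom (hopt ▸ EReal.coe_ne_top c)) k

variable {y : Vec m}

theorem norm_res_le (h : IsRun P γ₀ xc x xb yh yb) (hP : P.IsConvex) (hγ : 0 < γ₀)
    (hbdd : BddAbove ((fun x => ‖P.res x‖ ^ 2) '' P.X)) (hopt : P.optVal = c)
    (hy : (c : EReal) ≤ P.dual y) (k : ℕ) :
    ‖P.res (xb k)‖ ≤ 6 * P.resBound γ₀ xc ‖y‖ / (k + 2) := by
  have hD₁ := P.D₁_nonneg xc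
  have hDA := P.DA_nonneg
  have hupper := h.realObj_add_penalty_le_optVal hP hγ hbdd hopt k
  have hlower := hP.le_realObj_add_norm_mul_norm hy (h.mem_of_optVal_eq hP hopt k)
  refine le_of_penalty_le (s := 2 * γ₀ * (P.D₁ xc + 3 * P.DA) / (k + 2)) hγ (bet_pos hγ k)
    (norm_nonneg y) (by positivity) (by positivity) (norm_nonneg _) (bet_le hγ k) ?_ (by linarith)
  gcongr
  norm_num

theorem norm_mul_norm_res_le (h : IsRun P γ₀ xc x xb yh yb) (hP : P.IsConvex) (hγ : 0 < γ₀)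
    (hbdd : BddAbove ((fun x => ‖P.res x‖ ^ 2) '' P.X)) (hopt : P.optVal = c)
    (hy : (c : EReal) ≤ P.dual y) (k : ℕ) :
    ‖y‖ * ‖P.res (xb k)‖ ≤ 6 * P.objBound γ₀ xc ‖y‖ / (k + 2) :=
  calc ‖y‖ * ‖P.res (xb k)‖
    _ ≤ ‖y‖ * (6 * P.resBound γ₀ xc ‖y‖ / (k + 2)) := by
      gcongr
      exact h.norm_res_le hP hγ hbdd hopt hy k
    _ = 6 * (‖y‖ * P.resBound γ₀ xc ‖y‖) / (k + 2) := by ring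
    _ ≤ 6 * P.objBound γ₀ xc ‖y‖ / (k + 2) := by
      gcongr
      exact le_max_right _ _

theorem abs_realObj_sub_le (h : IsRun P γ₀ xc x xb yh yb) (hP : P.IsConvex) (hγ : 0 < γ₀)
    (hbdd : BddAbove ((fun x => ‖P.res x‖ ^ 2) '' P.X)) (hopt : P.optVal = c)
    (hy : (c : EReal) ≤ P.dual y) (k : ℕ) :
    |P.realObj (xb k) - c| ≤ 6 * P.objBound γ₀ xc ‖y‖ / (k + 2) := by
  have hupper := h.realObj_add_penalty_le_optVal hP hγ hbdd hopt k
  have hlower := hP.le_realObj_add_norm_mul_norm hy (h.mem_of_optVal_eq hP hopt k)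
  have hmult := h.norm_mul_norm_res_le hP hγ hbdd hopt hy k
  have herr := P.smoothing_error_le γ₀ xc ‖y‖ k
  have hpen := penalty_nonneg hγ k ‖P.res (xb k)‖
  exact abs_sub_le_iff.2 ⟨by linarith, by linarith⟩

theorem sub_le_dual (h : IsRun P γ₀ xc x xb yh yb) (hP : P.IsConvex) (hγ : 0 < γ₀)
    (hbdd : BddAbove ((fun x => ‖P.res x‖ ^ 2) '' P.X)) (hopt : P.optVal = c)
    (hy : (c : EReal) ≤ P.dual y) (k : ℕ) :
    ((c - 2 * (6 * P.objBound γ₀ xc ‖y‖ / (k + 2)) : ℝ) : EReal) ≤ P.dual (yb k) := by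
  refine hP.le_dual_iff.2 fun u hu => ?_
  have hgap := h.realObj_add_penalty_le hP hγ hbdd k hu
  have hlower := hP.le_realObj_add_norm_mul_norm hy (h.mem_of_optVal_eq hP hopt k)
  have hmult := h.norm_mul_norm_res_le hP hγ hbdd hopt hy k
  have herr := P.smoothing_error_le γ₀ xc ‖y‖ k
  have hpen := penalty_nonneg hγ k ‖P.res (xb k)‖
  linarith

theorem isApproxPrimalDual (h : IsRun P γ₀ xc x xb yh yb) (hP : P.IsConvex) (hγ : 0 < γ₀)
    (hbdd : BddAbove ((fun x => ‖P.res x‖ ^ 2) '' P.X)) (hopt : P.optVal = c)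
    (hy : (c : EReal) ≤ P.dual y) {ε : ℝ} (hε : 0 < ε) {k : ℕ}
    (hk : 12 * max (P.objBound γ₀ xc ‖y‖) (P.resBound γ₀ xc ‖y‖) / ε ≤ k + 2) :
    P.IsApproxPrimalDual ε (xb k) (yb k) := by
  have rate_le {d : ℝ} (hd : d ≤ max (P.objBound γ₀ xc ‖y‖) (P.resBound γ₀ xc ‖y‖)) :
      6 * d / (k + 2) ≤ ε / 2 := by
    rw [div_le_iff₀ hε] at hk
    rw [div_le_iff₀ (by positivity)]
    linarith
  have hobj := rate_le (le_max_left _ _)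
  have hres := rate_le (le_max_right _ _)
  have hmem := h.mem_of_optVal_eq hP hopt k
  have hlower := h.sub_le_dual hP hγ hbdd hopt hy k
  have hupper := (P.dual_le_optVal (yb k)).trans_eq hopt
  lift P.dual (yb k) to ℝ using ⟨ne_top_of_le_ne_top (EReal.coe_ne_top _) hupper,
    ne_bot_of_le_ne_bot (EReal.coe_ne_bot _) hlower⟩ with v hv
  rw [EReal.coe_le_coe_iff] at hlower hupper
  exact ⟨⟨hmem.1, ⟨_, c, hP.obj_eq hmem.2, hopt,
      by linarith [h.abs_realObj_sub_le hP hγ hbdd hopt hy k]⟩,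
      by linarith [h.norm_res_le hP hγ hbdd hopt hy k]⟩,
    v, c, hv.symm, (Problem.dualVal_eq_optVal ⟨y, hopt ▸ hy⟩).trans hopt,
    abs_sub_le_iff.2 ⟨by linarith, by linarith⟩⟩

end IsRun

end PADMM

open PADMM.Problem in
theorem corollary6p1_general {n₁ n₂ m : ℕ} (P : PADMM.Problem n₁ n₂ m) (hP : P.IsConvex)
    {γ₀ : ℝ} (hγ : 0 < γ₀) {fstar : ℝ} (hopt : P.optVal = (fstar : EReal))
    (hdual : ∃ y, P.optVal ≤ P.dual y)
    (hbdd : BddAbove ((fun x => ‖P.res x‖ ^ 2) '' P.X))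
    (xc : PADMM.Vec n₁) (x xb : ℕ → PADMM.Vec n₁ × PADMM.Vec n₂) (yh yb : ℕ → PADMM.Vec m)
    (hrun : PADMM.IsRun P γ₀ xc x xb yh yb) :
    ∃ DY : ℝ, IsLeast ((fun y => ‖y‖) '' P.dualSolutions) DY ∧
      (∀ k : ℕ, ∃ v : ℝ, P.obj (xb k) = (v : EReal) ∧
        |v - fstar| ≤ 6 * P.objBound γ₀ xc DY / (k + 2) ∧
        ‖P.res (xb k)‖ ≤ 6 * P.resBound γ₀ xc DY / (k + 2)) ∧
      (∀ ε : ℝ, 0 < ε → ∀ k : ℕ,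
        12 * max (P.objBound γ₀ xc DY) (P.resBound γ₀ xc DY) / ε ≤ k + 2 →
        P.IsApproxPrimalDual ε (xb k) (yb k)) := by
  obtain ⟨y, hysol, hyleast⟩ := hP.exists_isLeast_norm_dualSolutions hopt hdual
  have hy : (fstar : EReal) ≤ P.dual y := hopt ▸ (mem_dualSolutions_iff hdual).1 hysol
  exact ⟨‖y‖, hyleast, fun k => ⟨P.realObj (xb k), hP.obj_eq (hrun.mem_of_optVal_eq hP hopt k).2,
      hrun.abs_realObj_sub_le hP hγ hbdd hopt hy k, hrun.norm_res_le hP hγ hbdd hopt hy k⟩,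
    fun _ hε _ hk => hrun.isApproxPrimalDual hP hγ hbdd hopt hy hε hk⟩

theorem corollary6p1 {n₁ n₂ m : ℕ} (P : PADMM.Problem n₁ n₂ m) (hP : P.Standing)
    (hbdd : BddAbove ((fun x => ‖P.res x‖ ^ 2) '' P.X))
    (xc : PADMM.Vec n₁) (x xb : ℕ → PADMM.Vec n₁ × PADMM.Vec n₂) (yh yb : ℕ → PADMM.Vec m)
    (hrun : PADMM.IsRun P 3 xc x xb yh yb) :
    ∃ fstar DY : ℝ, P.optVal = (fstar : EReal) ∧
      IsLeast ((fun y => ‖y‖) '' P.dualSolutions) DY ∧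
      (∀ k : ℕ, ∃ v : ℝ, P.obj (xb k) = (v : EReal) ∧
        |v - fstar| ≤ 6 * P.Dmax xc DY / (k + 2) ∧
        ‖P.res (xb k)‖ ≤ 6 * (DY + √(P.D₁ xc + 4 * P.DA)) / (k + 2)) ∧
      (∀ ε : ℝ, 0 < ε → ∀ k : ℕ,
        12 * max (P.Dmax xc DY) (DY + √(P.D₁ xc + 4 * P.DA)) / ε ≤ k + 2 →
        P.IsApproxPrimalDual ε (xb k) (yb k)) := by
  obtain ⟨fstar, hopt⟩ := hP.exists_optVal_eq
  obtain ⟨DY, h⟩ := corollary6p1_general P hP.isConvex three_pos hopt hP.exists_optVal_le_dual hbdd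
    xc x xb yh yb hrun
  exact ⟨fstar, DY, hopt,
    by simpa [PADMM.Problem.objBound, PADMM.Problem.resBound, PADMM.Problem.Dmax] using h⟩
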